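/- Let $\mathbb{K}$ be a field of characteristic $0$, let $I$ be a finite set and let $\mathbf s=(s_i)_{i\in I}\in\mathbb{K}^I$. Notation. For a set $D$, let $\mathcal H_D$ be the decorated Connes–Kreimer Hopf algebra: the vector space with basis the isomorphism classes of $D$-decorated rooted forests (finite posets in which each element is covered by at most one element, with elements decorated by $D$), with disjoint union as product, coproduct $\Delta F=\sum_{A} A\otimes (F\setminus A)$ over the downsets $A$ of $F$, and counit $1$ on the empty forest and $0$ on all others. For $d\in D$, $B_+^{(d)}:\mathcal H_D\to\mathcal H_D$ is the linear map adjoining to each forest a new greatest element decorated by $d$. Let $\mathsf{Rio}=\mathbb{K}[\pi_1,\pi_2,\dots,y_1,y_2,\dots]$ be the Riordan Hopf algebra: with $\pi_0=y_0=1$, $\Pi(x)=\sum_{n\ge0}\pi_nx^{n+1}$ and $Y(x)=\sum_{n\ge0}y_nx^n$, its coproduct is the algebra morphism with $\Delta\pi_n=\sum_{k=0}^n[x^{n+1}]\Pi(x)^{k+1}\otimes\pi_k$ and $\Delta y_n=\sum_{j=0}^n[x^n]Y(x)\Pi(x)^j\otimes y_j$, and its counit kills all $\pi_n,y_n$ with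 $n\ge1$. The polynomial algebra $\mathbb{K}[L]$ has coproduct and counit the algebra morphisms with $\Delta L=1\otimes L+L\otimes1$ and $\varepsilon(L)=0$; a $1$-cocycle on $\mathbb{K}[L]$ is a linear map $\Lambda$ with $\Delta\Lambda=\Lambda\otimes1+(\mathrm{id}\otimes\Lambda)\Delta$. For a series $F(x)$ with constant term $1$ and $s\in\mathbb{K}$, $F(x)^s=\sum_{k\ge0}\binom{s}{k}(F(x)-1)^k$. Operators are applied to power series in $x$ coefficientwise. Theorem. (1) There is exactly one family $\mathbf T(x)=(T_i(x))_{i\in I}$ of series in $\mathcal H_{I\times\mathbb{Z}_{\ge1}}[[x]]$ with $$T_i(x)=1+\sum_{k\ge1}B_+^{(i,k)}\bigl(T_i(x)Q(x)^k\bigr)\quad(i\in I),\qquad Q(x)=x\prod_{j\in I}T_j(x)^{s_j}.$$ For every $i\in I$, the algebra morphism $\phi_i:\mathsf{Rio}\to\mathcal H_{I\times\mathbb{Z}_{\ge1}}$ determined by $\phi_i(Y(x))=T_i(x)$ and $\phi_i(\Pi(x))=Q(x)$ is a bialgebra morphism. (2) Let $(\Lambda_{i,k})_{i\in I,k\ge1}$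 be any family of $1$-cocycles on $\mathbb{K}[L]$. There is exactly one family $(G_i(x,L))_{i\in I}$ of series in $\mathbb{K}[L][[x]]$ with $$G_i(x,L)=1+\sum_{k\ge1}x^k\Lambda_{i,k}\Bigl(G_i(x,L)\prod_{j\in I}G_j(x,L)^{s_jk}\Bigr)\quad(i\in I),$$ and, for every $i\in I$, it satisfies the renormalization group equation $$\Bigl(\frac{\partial}{\partial L}-\beta(x)\frac{\partial}{\partial x}-\gamma_i(x)\Bigr)G_i(x,L)=0,$$ where $\gamma_i(x)$ is the linear term in $L$ of $G_i(x,L)$ and $\beta(x)=\sum_{j\in I}s_j\,x\,\gamma_j(x)$ is the same for all $i$. -/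

import Mathlib

open scoped TensorProduct

noncomputable section

namespace DysonSchwinger

/-! ### Decorated rooted forests -/

/-- A `D`-decorated rooted forest: a finite poset in which every element is covered by at most one
element (its parent; roots are the maximal elements), each element carrying a decoration in `D`. -/
structure Forest (D : Type*) where
  carrier : Type
  [order : PartialOrder carrier]
  [finite : Finite carrier]
  covBy_unique : ∀ a b c : carrier, a ⋖ b → a ⋖ c → b = c
  dec : carrier → D

attribute [instance] Forest.order Forest.finite

namespace Forest

variable {D : Type*}

/-- Isomorphism of decorated forests: an order isomorphism preserving decorations. -/
def Iso (F G : Forest D) : Prop :=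
  ∃ e : F.carrier ≃o G.carrier, ∀ v, G.dec (e v) = F.dec v

theorem Iso.refl (F : Forest D) : Iso F F := ⟨OrderIso.refl _, fun _ => rfl⟩

theorem Iso.symm {F G : Forest D} : Iso F G → Iso G F := by
  rintro ⟨e, he⟩
  exact ⟨e.symm, fun v => by rw [← he, e.apply_symm_apply]⟩

theorem Iso.trans {F G H : Forest D} : Iso F G → Iso G H → Iso F H := by
  rintro ⟨e, he⟩ ⟨f, hf⟩
  exact ⟨e.trans f, fun v => by rw [OrderIso.trans_apply, hf, he]⟩

instance setoid (D : Type*) : Setoid (Forest D) where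
  r := Iso
  iseqv := ⟨Iso.refl, Iso.symm, Iso.trans⟩

/-- The empty forest. -/
def empty (D : Type*) : Forest D where
  carrier := Empty
  covBy_unique a := a.elim
  dec a := a.elim

/-- The disjoint union of two forests. -/
def union (F G : Forest D) : Forest D where
  carrier := F.carrier ⊕ G.carrier
  covBy_unique := by
    have inl_cov : ∀ {a b : F.carrier},
        (Sum.inl a : F.carrier ⊕ G.carrier) ⋖ Sum.inl b → a ⋖ b := fun h =>
      ⟨Sum.inl_lt_inl_iff.1 h.1, fun c h₁ h₂ =>
        h.2 (Sum.inl_lt_inl_iff.2 h₁) (Sum.inl_lt_inl_iff.2 h₂)⟩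
    have inr_cov : ∀ {a b : G.carrier},
        (Sum.inr a : F.carrier ⊕ G.carrier) ⋖ Sum.inr b → a ⋖ b := fun h =>
      ⟨Sum.inr_lt_inr_iff.1 h.1, fun c h₁ h₂ =>
        h.2 (Sum.inr_lt_inr_iff.2 h₁) (Sum.inr_lt_inr_iff.2 h₂)⟩
    rintro (a | a) (b | b) (c | c) hb hc
    · rw [F.covBy_unique a b c (inl_cov hb) (inl_cov hc)]
    · exact absurd hc.1 Sum.not_inl_lt_inr
    · exact absurd hb.1 Sum.not_inl_lt_inr
    · exact absurd hb.1 Sum.not_inl_lt_inr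
    · exact absurd hb.1 Sum.not_inr_lt_inl
    · exact absurd hb.1 Sum.not_inr_lt_inl
    · exact absurd hc.1 Sum.not_inr_lt_inl
    · rw [G.covBy_unique a b c (inr_cov hb) (inr_cov hc)]
  dec := Sum.elim F.dec G.dec

/-- The forest on a convex set of vertices `s` of `F`, with the induced order and decorations.
It is used for downsets of `F` and for their complements. -/
def restrict (F : Forest D) (s : Set F.carrier) (hs : s.OrdConnected) : Forest D where
  carrier := s
  covBy_unique := by
    have cov : ∀ {a b : s}, a ⋖ b → (a : F.carrier) ⋖ b := fun {a b} h =>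
      ⟨h.1, fun c h₁ h₂ =>
        h.2 (c := ⟨c, hs.out a.2 b.2 ⟨h₁.le, h₂.le⟩⟩) h₁ h₂⟩
    intro a b c hb hc
    exact Subtype.ext (F.covBy_unique a b c (cov hb) (cov hc))
  dec v := F.dec v

/-- The sub-forest on a downset. -/
def down (F : Forest D) (s : LowerSet F.carrier) : Forest D :=
  F.restrict s s.lower.ordConnected

/-- The sub-forest on the complement of a downset. -/
def up (F : Forest D) (s : LowerSet F.carrier) : Forest D :=
  F.restrict (s : Set F.carrier)ᶜ s.lower.compl.ordConnected

/-- The tree obtained from `F` by adjoining a new root, decorated by `d`, above everything. -/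
def graft (d : D) (F : Forest D) : Forest D where
  carrier := WithTop F.carrier
  covBy_unique := by
    intro a b c hb hc
    induction a using WithTop.recTopCoe with
    | top => exact absurd hb.1 not_top_lt
    | coe a =>
      induction b using WithTop.recTopCoe with
      | top =>
        induction c using WithTop.recTopCoe with
        | top => rfl
        | coe c => exact absurd (WithTop.coe_lt_top c) (hb.2 hc.1)
      | coe b =>
        induction c using WithTop.recTopCoe with
        | top => exact absurd (WithTop.coe_lt_top b) (hc.2 hb.1)
        | coe c =>
          rw [F.covBy_unique a b c (WithTop.coe_covBy_coe.1 hb) (WithTop.coe_covBy_coe.1 hc)]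
  dec v := v.recTopCoe d F.dec

theorem Iso.union {F F' G G' : Forest D} :
    Iso F F' → Iso G G' → Iso (F.union G) (F'.union G') := by
  rintro ⟨e, he⟩ ⟨f, hf⟩
  exact ⟨OrderIso.sumCongr e f, by rintro (v | v); exacts [he v, hf v]⟩

theorem Iso.graft (d : D) {F G : Forest D} : Iso F G → Iso (F.graft d) (G.graft d) := by
  rintro ⟨e, he⟩
  refine ⟨e.withTopCongr, fun v => ?_⟩
  induction v using WithTop.recTopCoe with
  | top => rfl
  | coe v => exact he v

theorem iso_restrict {F G : Forest D} (e : F.carrier ≃o G.carrier)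
    (he : ∀ v, G.dec (e v) = F.dec v) (s : Set F.carrier) (t : Set G.carrier)
    (hs : s.OrdConnected) (ht : t.OrdConnected) (h : ∀ v, v ∈ s ↔ e v ∈ t) :
    Iso (F.restrict s hs) (G.restrict t ht) :=
  ⟨{ toEquiv := e.toEquiv.subtypeEquiv h
     map_rel_iff' := fun {a b} => e.le_iff_le (x := a.1) (y := b.1) }, fun v => he v.1⟩

end Forest

/-- Isomorphism classes of `D`-decorated rooted forests. -/
def ForestClass (D : Type*) := Quotient (Forest.setoid D)

namespace ForestClass

variable {D : Type*}

/-- The isomorphism class of a forest. -/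
def mk (F : Forest D) : ForestClass D := Quotient.mk _ F

/-- Isomorphism classes of forests form a commutative monoid under disjoint union. -/
instance : CommMonoid (ForestClass D) where
  one := mk (Forest.empty D)
  mul := Quotient.map₂ Forest.union fun _ _ h _ _ h' => Forest.Iso.union h h'
  mul_assoc := by
    rintro ⟨F⟩ ⟨G⟩ ⟨H⟩
    refine Quotient.sound ⟨OrderIso.sumAssoc _ _ _, ?_⟩
    rintro ((v | v) | v) <;> rfl
  one_mul := by
    rintro ⟨F⟩
    refine Quotient.sound ⟨{ toEquiv := Equiv.emptySum Empty F.carrier, map_rel_iff' := ?_ }, ?_⟩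
    · rintro (a | a) (b | b)
      · exact a.elim
      · exact a.elim
      · exact b.elim
      · exact Sum.inr_le_inr_iff.symm
    · rintro (v | v)
      · exact v.elim
      · rfl
  mul_one := by
    rintro ⟨F⟩
    refine Quotient.sound ⟨{ toEquiv := Equiv.sumEmpty F.carrier Empty, map_rel_iff' := ?_ }, ?_⟩
    · rintro (a | a) (b | b)
      · exact Sum.inl_le_inl_iff.symm
      · exact b.elim
      · exact a.elim
      · exact a.elim
    · rintro (v | v)
      · rfl
      · exact v.elim
  mul_comm := by
    rintro ⟨F⟩ ⟨G⟩
    refine Quotient.sound ⟨OrderIso.sumComm _ _, ?_⟩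
    rintro (v | v) <;> rfl

/-- Adjoin a root decorated by `d`. -/
def graft (d : D) : ForestClass D → ForestClass D :=
  Quotient.map (Forest.graft d) fun _ _ h => h.graft d

end ForestClass

/-! ### The decorated Connes--Kreimer Hopf algebra -/

/-- The decorated Connes--Kreimer algebra: the free vector space on isomorphism classes of
`D`-decorated forests, with disjoint union as multiplication. (This is a type synonym, since the
coproduct is not the group-like coproduct carried by a monoid algebra.) -/
def CK (K : Type*) [Field K] (D : Type*) := MonoidAlgebra K (ForestClass D)

namespace CK

variable (K : Type*) [Field K] {D : Type*}

instance : CommRing (CK K D) := inferInstanceAs (CommRing (MonoidAlgebra K (ForestClass D)))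

instance : Algebra K (CK K D) := inferInstanceAs (Algebra K (MonoidAlgebra K (ForestClass D)))

/-- The forests as a basis of the Connes--Kreimer algebra. -/
def basis : Module.Basis (ForestClass D) K (CK K D) :=
  Module.Basis.ofRepr (MonoidAlgebra.coeffLinearEquiv K : MonoidAlgebra K (ForestClass D) ≃ₗ[K] _)

/-- A forest as an element of the Connes--Kreimer algebra. -/
def of (F : ForestClass D) : CK K D := basis K F

/-- The coproduct of a forest, `∑ D ⊗ (F \ D)` over all downsets `D` of `F`. -/
def comulForest (F : Forest D) : CK K D ⊗[K] CK K D :=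
  ∑ᶠ s : LowerSet F.carrier, of K (.mk (F.down s)) ⊗ₜ[K] of K (.mk (F.up s))

theorem comulForest_congr {F G : Forest D} (h : F.Iso G) :
    comulForest K F = comulForest K G := by
  obtain ⟨e, he⟩ := h
  refine finsum_eq_of_bijective (LowerSet.map e) (LowerSet.map e).bijective fun s => ?_
  have h₁ : ForestClass.mk (F.down s) = .mk (G.down (LowerSet.map e s)) :=
    Quotient.sound (Forest.iso_restrict e he _ _ _ _ fun v => by simp)
  have h₂ : ForestClass.mk (F.up s) = .mk (G.up (LowerSet.map e s)) :=
    Quotient.sound (Forest.iso_restrict e he _ _ _ _ fun v => by simp)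
  rw [h₁, h₂]

/-- The coproduct of an isomorphism class of forests. -/
def comulClass (F : ForestClass D) : CK K D ⊗[K] CK K D :=
  Quotient.lift (comulForest K) (fun _ _ h => comulForest_congr K h) F

/-- The coproduct extends `comulClass` linearly; the counit sends the empty forest to `1` and
every other forest to `0`. -/
instance : CoalgebraStruct K (CK K D) where
  comul := (basis K).constr K (comulClass K)
  counit := (basis K).coord 1

/-- The linear operator `B₊^{(d)}`, which adjoins to each forest a root decorated by `d`. -/
def bPlus (d : D) : CK K D →ₗ[K] CK K D :=
  (basis K).constr K fun F => of K (F.graft d)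

end CK

/-! ### The Riordan Hopf algebra -/

/-- Generators of the Riordan Hopf algebra: `pi n` and `y n` stand for `π_{n+1}` and `y_{n+1}`. -/
inductive RioGen : Type
  | pi (n : ℕ)
  | y (n : ℕ)

/-- The Riordan Hopf algebra, as an algebra. -/
abbrev Rio (K : Type*) [Field K] := MvPolynomial RioGen K

namespace Rio

variable (K : Type*) [Field K]

/-- `π_n`, with the convention `π_0 = 1`. -/
def piGen : ℕ → Rio K
  | 0 => 1
  | n + 1 => MvPolynomial.X (RioGen.pi n)

/-- `y_n`, with the convention `y_0 = 1`. -/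
def yGen : ℕ → Rio K
  | 0 => 1
  | n + 1 => MvPolynomial.X (RioGen.y n)

/-- `Π(x) = x + ∑_{n ≥ 1} π_n x^{n+1}`. -/
def piSeries : PowerSeries (Rio K) := PowerSeries.X * PowerSeries.mk (piGen K)

/-- `Y(x) = 1 + ∑_{n ≥ 1} y_n x^n`. -/
def ySeries : PowerSeries (Rio K) := PowerSeries.mk (yGen K)

/-- `Δ π_n = ∑_{k=0}^n [x^{n+1}] Π(x)^{k+1} ⊗ π_k`. -/
def comulPi (n : ℕ) : Rio K ⊗[K] Rio K :=
  ∑ k ∈ Finset.range (n + 1),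
    PowerSeries.coeff (n + 1) (piSeries K ^ (k + 1)) ⊗ₜ[K] piGen K k

/-- `Δ y_n = ∑_{j=0}^n [x^n] Y(x) Π(x)^j ⊗ y_j`. -/
def comulY (n : ℕ) : Rio K ⊗[K] Rio K :=
  ∑ j ∈ Finset.range (n + 1),
    PowerSeries.coeff n (ySeries K * piSeries K ^ j) ⊗ₜ[K] yGen K j

/-- The coproduct is the algebra morphism with the above values on generators; the counit is the
algebra morphism sending all the generators to `0`. -/
instance : CoalgebraStruct K (Rio K) where
  comul := (MvPolynomial.aeval fun g => match g with
    | RioGen.pi n => comulPi K (n + 1)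
    | RioGen.y n => comulY K (n + 1) : Rio K →ₐ[K] Rio K ⊗[K] Rio K).toLinearMap
  counit := (MvPolynomial.aeval fun _ => 0 : Rio K →ₐ[K] K).toLinearMap

end Rio

/-! ### The polynomial Hopf algebra -/

/-- The coalgebra structure on `K[L]` with `Δ L = 1 ⊗ L + L ⊗ 1` and `ε(L) = 0`, both extended to
algebra morphisms. -/
instance polynomialCoalgebraStruct (K : Type*) [Field K] : CoalgebraStruct K (Polynomial K) where
  comul := (Polynomial.aeval
    ((1 : Polynomial K) ⊗ₜ[K] (Polynomial.X : Polynomial K) + Polynomial.X ⊗ₜ[K] 1)).toLinearMap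
  counit := (Polynomial.aeval (0 : K)).toLinearMap

/-- `Λ` is a 1-cocycle: `Δ Λ = Λ ⊗ 1 + (id ⊗ Λ) Δ`. -/
def IsOneCocycle {K H : Type*} [Field K] [CommRing H] [Algebra K H] [CoalgebraStruct K H]
    (Λ : H →ₗ[K] H) : Prop :=
  ∀ h : H, CoalgebraStruct.comul (R := K) (Λ h) =
    Λ h ⊗ₜ[K] 1 + LinearMap.lTensor H Λ (CoalgebraStruct.comul (R := K) h)

/-! ### Dyson--Schwinger systems -/

/-- `F(x)^s = ∑_k s(s-1)⋯(s-k+1)/k! (F(x) - 1)^k` for a series `F` with constant term `1` and a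
scalar exponent `s`; the terms with `k > n` do not contribute to the coefficient of `x^n`. -/
def spow {K A : Type*} [Field K] [CommRing A] [Algebra K A] (F : PowerSeries A) (s : K) :
    PowerSeries A :=
  PowerSeries.mk fun n => ∑ k ∈ Finset.range (n + 1),
    ((descPochhammer K k).eval s / (k.factorial : K)) • PowerSeries.coeff n ((F - 1) ^ k)

variable {K I : Type*} [Field K] [Fintype I]

/-- The invariant charge `Q(x) = x ∏_j T_j(x)^{s_j}`. -/
def invariantCharge {A : Type*} [CommRing A] [Algebra K A] (s : I → K)
    (T : I → PowerSeries A) : PowerSeries A :=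
  PowerSeries.X * ∏ j, spow (T j) (s j)

/-- `T` solves `T_i(x) = 1 + ∑_{k ≥ 1} B₊^{(i,k)}(T_i(x) Q(x)^k)` for all `i`, where operators act
coefficientwise. As `x^k` divides `Q(x)^k`, only the terms with `1 ≤ k ≤ n` contribute to the
coefficient of `x^n`; here `k` is written as `m + 1`. -/
def IsCombSolution (s : I → K) (T : I → PowerSeries (CK K (I × ℕ+))) : Prop :=
  ∀ i n, PowerSeries.coeff n (T i) = PowerSeries.coeff n (1 : PowerSeries (CK K (I × ℕ+))) +
    ∑ m ∈ Finset.range n, CK.bPlus K (i, m.succPNat)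
      (PowerSeries.coeff n (T i * invariantCharge s T ^ (m + 1)))

/-- `G` solves `G_i(x,L) = 1 + ∑_{k ≥ 1} x^k Λ_{i,k}(G_i(x,L) ∏_j G_j(x,L)^{s_j k})` for all `i`,
where `G_i(x,L)` is a power series in `x` with coefficients in `K[L]` and operators act
coefficientwise. Only the terms with `1 ≤ k ≤ n` contribute to the coefficient of `x^n`; here `k`
is written as `m + 1`. -/
def IsDSESolution (s : I → K) (Λ : I → ℕ+ → Polynomial K →ₗ[K] Polynomial K)
    (G : I → PowerSeries (Polynomial K)) : Prop :=
  ∀ i n, PowerSeries.coeff n (G i) = PowerSeries.coeff n (1 : PowerSeries (Polynomial K)) +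
    ∑ m ∈ Finset.range n, Λ i m.succPNat
      (PowerSeries.coeff (n - (m + 1))
        (G i * ∏ j, spow (G j) (s j * ((m + 1 : ℕ) : K))))

/-- `∂/∂L` on `K[L][[x]]`. -/
def derivL (G : PowerSeries (Polynomial K)) : PowerSeries (Polynomial K) :=
  PowerSeries.mk fun n => Polynomial.derivative (PowerSeries.coeff n G)

/-- `∂/∂x` on `K[L][[x]]`. -/
def derivX (G : PowerSeries (Polynomial K)) : PowerSeries (Polynomial K) :=
  PowerSeries.derivative (Polynomial K) G

/-- The linear term in `L` of a series in `K[L][[x]]`, as a series in `K[[x]]`. -/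
def linL (G : PowerSeries (Polynomial K)) : PowerSeries K :=
  PowerSeries.mk fun n => (PowerSeries.coeff n G).coeff 1

/-- The renormalization group equation `(∂/∂L - β(x) ∂/∂x - γ(x)) G(x,L) = 0`. -/
def SatisfiesRGE (β γ : PowerSeries K) (G : PowerSeries (Polynomial K)) : Prop :=
  derivL G - PowerSeries.map Polynomial.C β * derivX G - PowerSeries.map Polynomial.C γ * G = 0

/-- The `β`-function `β(x) = ∑_j s_j x γ_j(x)`, where `γ_j(x)` is the linear term in `L` of
`G_j(x,L)`. -/
def betaFunction (s : I → K) (G : I → PowerSeries (Polynomial K)) : PowerSeries K :=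
  ∑ j, s j • (PowerSeries.X * linL (G j))

end DysonSchwinger

end

open scoped TensorProduct

noncomputable section

namespace DysonSchwinger

open PowerSeries (coeff constantCoeff)

/-! ### Power series: coefficients of powers and substitution -/

section Series

variable {A : Type*} [CommRing A]

/-! Both parts are instances of one system, `IsSystemSolution`, over a commutative algebra: T_i =
c_i + ∑ B_{i,m}(T_i Q^{m+1}), with arbitrary linear operators and arbitrary inhomogeneities c_i.
Since Q is divisible by x, the coefficient of x^n on the right only involves lower coefficients of
the T_j, so there is exactly one solution (`existsUnique_isSystemSolution`).

This uniqueness, used over H ⊗ H, also computes coproducts. Suppose the B_{i,m} are 1-cocycles for a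
multiplicative Δ, and c_i = 1. Applying Δ to the equations shows that the ΔT_i solve the system with
operators id ⊗ B_{i,m} and inhomogeneities T_i ⊗ 1. The series (T_i ⊗ 1) · ∑_j Q^j ⊗ [x^j]T_i solve
it too: F ↦ ∑_j Q^j ⊗ [x^j]F is a substitution, hence multiplicative and compatible with the powers
F^s, and id ⊗ B is linear over the left factor. So the two families agree (`map_comul_solution`),
and ΔQ = ∑_j Q^j ⊗ [x^j]Q follows. The only delicate ingredient is (FG)^s = F^s G^s, obtained by
interpolating from natural s (`mul_spow`).

For part (1), the operators B₊ are 1-cocycles on the Connes–Kreimer algebra, and the formulas for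
ΔT_i and ΔQ are exactly the Riordan coproduct on generators.

For part (2), the factor x^k is absorbed into Q^k (`isDSESolution_iff`). Taking the coefficient of L
in the left tensor factor turns Δ into ∂/∂L. Cocycles take values in the kernel of the counit, so
G_i = 1 and Q = x at L = 0; hence the linear term of G_i Q^j is γ_i x^j + j x^{j-1} β, where β is
the linear term of Q. Summing against [x^j]G_i gives γ_i G_i + β ∂G_i/∂x. -/

theorem coeff_pow_eq_zero {F : PowerSeries A} (hF : constantCoeff F = 0) {n k : ℕ} (h : n < k) :
    coeff n (F ^ k) = 0 :=
  PowerSeries.X_pow_dvd_iff.1 (pow_dvd_pow_of_dvd (PowerSeries.X_dvd_iff.2 hF) k) n h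

theorem coeff_mul_pow_eq_zero {F : PowerSeries A} (hF : constantCoeff F = 0) (G : PowerSeries A)
    {n k : ℕ} (h : n < k) : coeff n (G * F ^ k) = 0 :=
  PowerSeries.X_pow_dvd_iff.1
    ((pow_dvd_pow_of_dvd (PowerSeries.X_dvd_iff.2 hF) k).mul_left G) n h

theorem coeff_subst_eq_sum {a : PowerSeries A} (ha : constantCoeff a = 0) (f : PowerSeries A)
    {n N : ℕ} (h : n ≤ N) :
    coeff n (f.subst a) = ∑ d ∈ Finset.range (N + 1), coeff d f * coeff n (a ^ d) := by
  rw [PowerSeries.coeff_subst' (PowerSeries.HasSubst.of_constantCoeff_zero' ha)]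
  rw [finsum_eq_sum_of_support_subset]
  · rfl
  · intro d hd
    by_contra hdn
    refine hd ?_
    have : n < d := by simp at hdn; omega
    simp [coeff_pow_eq_zero ha this]

/-- Congruence of power series modulo `x ^ n`. -/
def residue (A : Type*) [CommRing A] (n : ℕ) :
    PowerSeries A →+* PowerSeries A ⧸ Ideal.span {(PowerSeries.X : PowerSeries A) ^ n} :=
  Ideal.Quotient.mk _

theorem residue_eq_iff {n : ℕ} {F G : PowerSeries A} :
    residue A n F = residue A n G ↔ ∀ k < n, coeff k F = coeff k G := by
  rw [residue, Ideal.Quotient.eq, Ideal.mem_span_singleton, PowerSeries.X_pow_dvd_iff]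
  simp [sub_eq_zero]

theorem residue_X_mul {n : ℕ} {F G : PowerSeries A} (h : residue A n F = residue A n G) :
    residue A (n + 1) (PowerSeries.X * F) = residue A (n + 1) (PowerSeries.X * G) := by
  rw [residue_eq_iff] at h ⊢
  rintro (_ | k) hk
  · simp
  · simpa [PowerSeries.coeff_succ_X_mul] using h k (by omega)

/-- A self-map of a power of `A[[x]]` such that the coefficients of order `n` of the output are
determined by the coefficients of order less than `n` of the input has exactly one fixed point. -/
theorem existsUnique_fixedPoint {I : Type*} (Φ : (I → PowerSeries A) → I → PowerSeries A)
    (hΦ : ∀ n T T', (∀ i, residue A n (T i) = residue A n (T' i)) →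
      ∀ i, coeff n (Φ T i) = coeff n (Φ T' i)) :
    ∃! T, ∀ i n, coeff n (T i) = coeff n (Φ T i) := by
  -- Each application of Φ fixes one more coefficient, so the iterates from 0 stabilize x-adically.
  have step : ∀ n k i, k < n → coeff k (Φ^[n] 0 i) = coeff k (Φ^[n + 1] 0 i) := by
    intro n
    induction n with
    | zero => intro k i hk; omega
    | succ n ih =>
      intro k i hk
      rw [Function.iterate_succ_apply', Function.iterate_succ_apply' (n := n + 1)]
      exact hΦ k _ _ (fun j => residue_eq_iff.2 fun l hl => ih l j (by omega)) i
  have stable : ∀ k i m, coeff k (Φ^[k + 1] 0 i) = coeff k (Φ^[k + 1 + m] 0 i) := by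
    intro k i m
    induction m with
    | zero => rfl
    | succ m ih => rw [ih, step _ _ _ (by omega), add_assoc]
  refine ⟨fun i => PowerSeries.mk fun n => coeff n (Φ^[n + 1] 0 i), fun i n => ?_, fun T hT => ?_⟩
  · rw [PowerSeries.coeff_mk, Function.iterate_succ_apply']
    refine hΦ n _ _ (fun j => residue_eq_iff.2 fun k hk => ?_) i
    obtain ⟨m, rfl⟩ := Nat.exists_eq_add_of_lt hk
    rw [PowerSeries.coeff_mk, stable k j m, add_right_comm]
  · have key : ∀ n i, coeff n (T i) = coeff n (Φ^[n + 1] 0 i) := by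
      intro n
      induction n using Nat.strong_induction_on with
      | _ n ih =>
        intro i
        rw [hT, Function.iterate_succ_apply']
        refine hΦ n _ _ (fun j => residue_eq_iff.2 fun k hk => ?_) i
        obtain ⟨m, rfl⟩ := Nat.exists_eq_add_of_lt hk
        rw [ih k hk, stable k j m, add_right_comm]
    funext i
    ext n
    simp [key]

end Series

/-! ### Powers of power series with exponents in the base field -/

section PolynomialFunction

variable {K A : Type*} [Field K] [CommRing A] [Algebra K A]

/-- Functions `K → A` given by a polynomial with coefficients in `A`. -/
def IsPolynomialFunction (f : K → A) : Prop :=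
  ∃ p : Polynomial A, ∀ s, f s = p.eval (algebraMap K A s)

namespace IsPolynomialFunction

theorem const (a : A) : IsPolynomialFunction (fun _ : K => a) := ⟨Polynomial.C a, by simp⟩

theorem add {f g : K → A} (hf : IsPolynomialFunction f) (hg : IsPolynomialFunction g) :
    IsPolynomialFunction fun s => f s + g s := by
  obtain ⟨p, hp⟩ := hf
  obtain ⟨q, hq⟩ := hg
  exact ⟨p + q, by simp [hp, hq]⟩

theorem mul {f g : K → A} (hf : IsPolynomialFunction f) (hg : IsPolynomialFunction g) :
    IsPolynomialFunction fun s => f s * g s := by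
  obtain ⟨p, hp⟩ := hf
  obtain ⟨q, hq⟩ := hg
  exact ⟨p * q, by simp [hp, hq]⟩

theorem sum {ι : Type*} (t : Finset ι) {f : ι → K → A} (h : ∀ i ∈ t, IsPolynomialFunction (f i)) :
    IsPolynomialFunction fun s => ∑ i ∈ t, f i s := by
  classical
  induction t using Finset.induction_on with
  | empty => simpa using const 0
  | insert i t hi ih =>
    simp only [Finset.sum_insert hi]
    exact (h i (by simp)).add (ih fun j hj => h j (by simp [hj]))

theorem eval_smul (p : Polynomial K) (a : A) : IsPolynomialFunction fun s : K => p.eval s • a :=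
  ⟨p.map (algebraMap K A) * Polynomial.C a, fun s => by
    simp [Polynomial.eval_map_algebraMap, Polynomial.aeval_algebraMap_apply, Algebra.smul_def]⟩

theorem comp_mul_right {f : K → A} (hf : IsPolynomialFunction f) (c : K) :
    IsPolynomialFunction fun s => f (s * c) := by
  obtain ⟨p, hp⟩ := hf
  exact ⟨p.comp (Polynomial.X * Polynomial.C (algebraMap K A c)), fun s => by simp [hp, mul_comm s c]⟩

/-- `A` need not be a domain, so roots are counted in `K`: linear functionals separate points of
`A`, and a functional applied to the coefficients of the difference gives a polynomial over `K` with
all natural numbers as roots. -/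
theorem eq_of_natCast [CharZero K] {f g : K → A} (hf : IsPolynomialFunction f)
    (hg : IsPolynomialFunction g) (h : ∀ n : ℕ, f n = g n) (s : K) : f s = g s := by
  obtain ⟨p, hp⟩ := hf
  obtain ⟨q, hq⟩ := hg
  rw [← sub_eq_zero, ← Module.forall_dual_apply_eq_zero_iff K]
  intro l
  let r : Polynomial K := ∑ i ∈ (p - q).support, Polynomial.monomial i (l ((p - q).coeff i))
  have hr : ∀ t : K, l (f t - g t) = r.eval t := by
    intro t
    rw [hp, hq, ← Polynomial.eval_sub, Polynomial.eval_eq_sum, Polynomial.sum, map_sum,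
      Polynomial.eval_finsetSum]
    refine Finset.sum_congr rfl fun i _ => ?_
    rw [Polynomial.eval_monomial, ← map_pow, mul_comm, ← Algebra.smul_def, map_smul, smul_eq_mul,
      mul_comm]
  have h0 : r = 0 := by
    refine Polynomial.eq_zero_of_infinite_isRoot _
      ((Set.infinite_range_of_injective (Nat.cast_injective (R := K))).mono ?_)
    rintro _ ⟨n, rfl⟩
    rw [Set.mem_ofPred_eq, Polynomial.IsRoot, ← hr, h, sub_self, map_zero]
  rw [hr, h0, Polynomial.eval_zero]

end IsPolynomialFunction

end PolynomialFunction

/-! ### Binomial powers: functoriality, substitution, exponent laws -/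

section Spow

variable {K A B : Type*} [Field K] [CommRing A] [Algebra K A] [CommRing B] [Algebra K B]

/-- The binomial coefficient of an element of a field of characteristic zero. -/
def fieldChoose (s : K) (k : ℕ) : K := (descPochhammer K k).eval s / (k.factorial : K)

/-- F - 1 has no constant term, so the cut-off in the definition may be raised freely; this gives
different coefficients a common summation range. -/
theorem coeff_spow {F : PowerSeries A} (hF : constantCoeff F = 1) (s : K) {n N : ℕ} (h : n ≤ N) :
    coeff n (spow F s) =
      ∑ k ∈ Finset.range (N + 1), fieldChoose s k • coeff n ((F - 1) ^ k) := by
  rw [spow, PowerSeries.coeff_mk]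
  refine Finset.sum_subset (by simpa using h) fun k _ hk => ?_
  rw [coeff_pow_eq_zero (by simp [hF]) (by simpa using hk), smul_zero]

theorem constantCoeff_spow (F : PowerSeries A) (s : K) : constantCoeff (spow F s) = 1 := by
  rw [← PowerSeries.coeff_zero_eq_constantCoeff_apply, spow, PowerSeries.coeff_mk]
  simp

theorem residue_spow {n : ℕ} {F G : PowerSeries A} (s : K) (h : residue A n F = residue A n G) :
    residue A n (spow F s) = residue A n (spow G s) := by
  rw [residue_eq_iff]
  intro k hk
  simp only [spow, PowerSeries.coeff_mk]
  refine Finset.sum_congr rfl fun m _ => ?_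
  congr 1
  have : residue A n ((F - 1) ^ m) = residue A n ((G - 1) ^ m) := by simp [h]
  exact residue_eq_iff.1 this k hk

theorem one_spow (s : K) : spow (1 : PowerSeries A) s = 1 := by
  ext n
  rw [coeff_spow (by simp) s le_rfl, Finset.sum_range_succ']
  simp [fieldChoose]

theorem map_spow (f : A →ₐ[K] B) (F : PowerSeries A) (s : K) :
    PowerSeries.map (f : A →+* B) (spow F s) = spow (PowerSeries.map (f : A →+* B) F) s := by
  ext n
  simp only [PowerSeries.coeff_map, spow, PowerSeries.coeff_mk, map_sum]
  refine Finset.sum_congr rfl fun k _ => ?_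
  rw [← map_one (PowerSeries.map (f : A →+* B)), ← map_sub, ← map_pow, PowerSeries.coeff_map]
  exact map_smul f _ _

theorem subst_spow {a F : PowerSeries A} (ha : constantCoeff a = 0) (hF : constantCoeff F = 1)
    (s : K) : (spow F s).subst a = spow (F.subst a) s := by
  have hs := PowerSeries.HasSubst.of_constantCoeff_zero' ha
  have h1 : (1 : PowerSeries A).subst a = (1 : PowerSeries A) := by
    rw [← PowerSeries.coe_substAlgHom hs, map_one]
  have hc : constantCoeff (F.subst a) = 1 := by
    rw [← PowerSeries.coeff_zero_eq_constantCoeff_apply, coeff_subst_eq_sum ha _ le_rfl]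
    simp [hF]
  ext n
  rw [coeff_subst_eq_sum ha _ le_rfl, coeff_spow hc s le_rfl]
  have e : ∀ k, coeff n ((F.subst a - 1) ^ k) =
      ∑ d ∈ Finset.range (n + 1), coeff d ((F - 1) ^ k) * coeff n (a ^ d) := by
    intro k
    rw [← coeff_subst_eq_sum ha _ le_rfl, PowerSeries.subst_pow hs, PowerSeries.subst_sub hs, h1]
  simp_rw [e, Finset.smul_sum]
  rw [Finset.sum_comm]
  refine Finset.sum_congr rfl fun d hd => ?_
  rw [coeff_spow hF s (Finset.mem_range_succ_iff.1 hd), Finset.sum_mul]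
  simp

theorem fieldChoose_natCast [CharZero K] (m k : ℕ) : fieldChoose (m : K) k = (m.choose k : K) := by
  rw [fieldChoose, descPochhammer_eval_eq_descFactorial, Nat.descFactorial_eq_factorial_mul_choose,
    Nat.cast_mul, mul_div_cancel_left₀]
  exact_mod_cast k.factorial_ne_zero

theorem spow_natCast [CharZero K] {F : PowerSeries A} (hF : constantCoeff F = 1) (m : ℕ) :
    spow F (m : K) = F ^ m := by
  ext n
  -- The bound n + m covers both the cut-off n of `spow` and the m + 1 terms of the binomial
  -- theorem.
  rw [coeff_spow hF _ (Nat.le_add_right n m)]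
  conv_rhs => rw [← sub_add_cancel F 1, add_pow]
  simp only [one_pow, mul_one, map_sum]
  rw [Finset.sum_subset (Finset.range_subset_range.2 (by omega : m + 1 ≤ n + m + 1))]
  · refine Finset.sum_congr rfl fun k _ => ?_
    rw [fieldChoose_natCast, ← map_natCast (PowerSeries.C (R := A)), PowerSeries.coeff_mul_C,
      mul_comm, Algebra.smul_def, map_natCast]
  · intro k _ hk
    rw [Nat.choose_eq_zero_of_lt (by simpa using hk), Nat.cast_zero, mul_zero, map_zero]

theorem isPolynomialFunction_coeff_spow (F : PowerSeries A) (n : ℕ) :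
    IsPolynomialFunction fun s : K => coeff n (spow F s) := by
  simp only [spow, PowerSeries.coeff_mk, div_eq_mul_inv, mul_smul]
  exact .sum _ fun k _ => .eval_smul _ _

theorem isPolynomialFunction_coeff_mul {F G : K → PowerSeries A}
    (hF : ∀ n, IsPolynomialFunction fun s => coeff n (F s))
    (hG : ∀ n, IsPolynomialFunction fun s => coeff n (G s)) (n : ℕ) :
    IsPolynomialFunction fun s => coeff n (F s * G s) := by
  simp only [PowerSeries.coeff_mul]
  exact .sum _ fun k _ => (hF _).mul (hG _)

theorem isPolynomialFunction_coeff_pow {F : K → PowerSeries A}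
    (hF : ∀ n, IsPolynomialFunction fun s => coeff n (F s)) (k n : ℕ) :
    IsPolynomialFunction fun s => coeff n (F s ^ k) := by
  induction k generalizing n with
  | zero => simpa using .const _
  | succ k ih => simpa only [pow_succ] using isPolynomialFunction_coeff_mul ih hF n

/-- For fixed n both coefficients are polynomial in s, and for natural s the identity is `mul_pow`.
-/
theorem mul_spow [CharZero K] {F G : PowerSeries A} (hF : constantCoeff F = 1) (hG : constantCoeff G = 1)
    (s : K) : spow (F * G) s = spow F s * spow G s := by
  ext n
  refine (isPolynomialFunction_coeff_spow (F * G) n).eq_of_natCast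
    (isPolynomialFunction_coeff_mul (isPolynomialFunction_coeff_spow F)
      (isPolynomialFunction_coeff_spow G) n) (fun m => ?_) s
  rw [spow_natCast (by simp [hF, hG]), spow_natCast hF, spow_natCast hG, mul_pow]

/-- Again by interpolation in s. This identifies the exponents s_j k of part (2) with k-th powers of
the invariant charge. -/
theorem spow_mul_natCast [CharZero K] {F : PowerSeries A} (hF : constantCoeff F = 1) (s : K) (k : ℕ) :
    spow F (s * k) = spow F s ^ k := by
  ext n
  refine ((isPolynomialFunction_coeff_spow F n).comp_mul_right (k : K)).eq_of_natCast
    (isPolynomialFunction_coeff_pow (isPolynomialFunction_coeff_spow F) k n) (fun m => ?_) s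
  rw [← Nat.cast_mul, spow_natCast hF, spow_natCast hF, pow_mul]

end Spow

/-! ### Systems of fixed point equations in a commutative algebra -/

section System

variable {K I A A' : Type*} [Field K] [Fintype I] [CommRing A] [Algebra K A]
  [CommRing A'] [Algebra K A']

/-- `T` solves `T_i(x) = c_i(x) + ∑_{m ≥ 0} B_{i,m}(T_i(x) Q(x)^{m+1})` for all `i`. -/
def IsSystemSolution (s : I → K) (B : I → ℕ → A →ₗ[K] A) (c T : I → PowerSeries A) : Prop :=
  ∀ i n, coeff n (T i) = coeff n (c i) +
    ∑ m ∈ Finset.range n, B i m (coeff n (T i * invariantCharge s T ^ (m + 1)))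

theorem constantCoeff_invariantCharge (s : I → K) (T : I → PowerSeries A) :
    constantCoeff (invariantCharge s T) = 0 := by
  simp [invariantCharge]

theorem coeff_one_invariantCharge (s : I → K) (T : I → PowerSeries A) :
    coeff 1 (invariantCharge s T) = 1 := by
  rw [invariantCharge, ← zero_add 1, PowerSeries.coeff_succ_X_mul,
    PowerSeries.coeff_zero_eq_constantCoeff_apply, map_prod]
  simp [constantCoeff_spow]

theorem map_invariantCharge (f : A →ₐ[K] A') (s : I → K) (T : I → PowerSeries A) :
    PowerSeries.map (f : A →+* A') (invariantCharge s T) =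
      invariantCharge s fun i => PowerSeries.map (f : A →+* A') (T i) := by
  simp only [invariantCharge, map_mul, map_prod, map_spow, PowerSeries.map_X]

/-- The explicit factor x in Q gains one order of precision. This is the triangularity behind
existence and uniqueness. -/
theorem residue_mul_invariantCharge_pow {s : I → K} {n : ℕ} {T T' : I → PowerSeries A}
    (h : ∀ i, residue A n (T i) = residue A n (T' i)) (i : I) (m : ℕ) :
    residue A (n + 1) (T i * invariantCharge s T ^ (m + 1)) =
      residue A (n + 1) (T' i * invariantCharge s T' ^ (m + 1)) := by
  have e : ∀ T : I → PowerSeries A, T i * invariantCharge s T ^ (m + 1) =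
      PowerSeries.X * (T i * (∏ j, spow (T j) (s j)) * invariantCharge s T ^ m) := by
    intro T
    rw [pow_succ]
    conv_lhs => rw [invariantCharge]
    conv_rhs => rw [invariantCharge]
    ring
  rw [e, e]
  refine residue_X_mul ?_
  simp only [invariantCharge, map_mul, map_pow, map_prod, h, fun j => residue_spow (s j) (h j)]

theorem existsUnique_isSystemSolution (s : I → K) (B : I → ℕ → A →ₗ[K] A)
    (c : I → PowerSeries A) : ∃! T, IsSystemSolution s B c T := by
  have := existsUnique_fixedPoint (A := A) (I := I)
    (fun T i => PowerSeries.mk fun n => coeff n (c i) +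
      ∑ m ∈ Finset.range n, B i m (coeff n (T i * invariantCharge s T ^ (m + 1))))
    (fun n T T' h i => by
      simp only [PowerSeries.coeff_mk]
      congr 1
      refine Finset.sum_congr rfl fun m _ => ?_
      rw [residue_eq_iff.1 (residue_mul_invariantCharge_pow h i m) n n.lt_succ_self])
  simp only [PowerSeries.coeff_mk] at this
  exact this

theorem IsSystemSolution.constantCoeff {s : I → K} {B : I → ℕ → A →ₗ[K] A}
    {c T : I → PowerSeries A} (h : IsSystemSolution s B c T) (i : I) :
    constantCoeff (T i) = constantCoeff (c i) := by
  simpa using h i 0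

end System

/-! ### Cocycle operators and the coproduct of the solution -/

section Cocycle

variable {K I H : Type*} [Field K] [Fintype I] [CommRing H] [Algebra K H]

/-- The embedding of `H[[x]]` into `(H ⊗ H)[[x]]` through the left factor. -/
def leftSeries : PowerSeries H →+* PowerSeries (H ⊗[K] H) :=
  PowerSeries.map ((Algebra.TensorProduct.includeLeft : H →ₐ[K] H ⊗[K] H) : H →+* H ⊗[K] H)

/-- The embedding of `H[[x]]` into `(H ⊗ H)[[x]]` through the right factor. -/
def rightSeries : PowerSeries H →+* PowerSeries (H ⊗[K] H) :=
  PowerSeries.map ((Algebra.TensorProduct.includeRight : H →ₐ[K] H ⊗[K] H) : H →+* H ⊗[K] H)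

@[simp] theorem coeff_leftSeries (F : PowerSeries H) (n : ℕ) :
    coeff n (leftSeries (K := K) F) = coeff n F ⊗ₜ[K] 1 := by
  simp [leftSeries]

@[simp] theorem coeff_rightSeries (F : PowerSeries H) (n : ℕ) :
    coeff n (rightSeries (K := K) F) = 1 ⊗ₜ[K] coeff n F := by
  simp [rightSeries]

theorem constantCoeff_leftSeries {F : PowerSeries H} (hF : constantCoeff F = 0) :
    constantCoeff (leftSeries (K := K) F) = 0 := by
  rw [← PowerSeries.coeff_zero_eq_constantCoeff_apply, coeff_leftSeries,
    PowerSeries.coeff_zero_eq_constantCoeff_apply, hF, TensorProduct.zero_tmul]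

/-- The series `∑_j Q(x)^j ⊗ [x^j] F(x)`. -/
def composeTensor (K : Type*) [Field K] [Algebra K H] (Q F : PowerSeries H) :
    PowerSeries (H ⊗[K] H) :=
  (rightSeries (K := K) F).subst (leftSeries (K := K) Q)

theorem coeff_leftSeries_mul_composeTensor {Q : PowerSeries H} (hQ : constantCoeff Q = 0)
    (P F : PowerSeries H) (n : ℕ) :
    coeff n (leftSeries (K := K) P * composeTensor K Q F) =
      ∑ d ∈ Finset.range (n + 1), coeff n (P * Q ^ d) ⊗ₜ[K] coeff d F := by
  have hd : ∀ d, coeff n (P * Q ^ d) ⊗ₜ[K] coeff d F =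
      coeff n (leftSeries (K := K) P * leftSeries (K := K) Q ^ d) *
        coeff d (rightSeries (K := K) F) := by
    intro d
    rw [← map_pow, ← map_mul, coeff_leftSeries, coeff_rightSeries,
      Algebra.TensorProduct.tmul_mul_tmul, one_mul, mul_one]
  simp_rw [hd, PowerSeries.coeff_mul n, Finset.sum_mul]
  rw [Finset.sum_comm]
  refine Finset.sum_congr rfl fun p hp => ?_
  rw [composeTensor, coeff_subst_eq_sum (constantCoeff_leftSeries hQ) _
    (by rw [Finset.HasAntidiagonal.mem_antidiagonal] at hp; omega : p.2 ≤ n), Finset.mul_sum]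
  exact Finset.sum_congr rfl fun d _ => by ring

theorem coeff_composeTensor {Q : PowerSeries H} (hQ : constantCoeff Q = 0)
    (F : PowerSeries H) (n : ℕ) :
    coeff n (composeTensor K Q F) =
      ∑ d ∈ Finset.range (n + 1), coeff n (Q ^ d) ⊗ₜ[K] coeff d F := by
  simpa using coeff_leftSeries_mul_composeTensor (K := K) hQ 1 F n

theorem composeTensor_mul {Q : PowerSeries H} (hQ : constantCoeff Q = 0) (F G : PowerSeries H) :
    composeTensor K Q (F * G) = composeTensor K Q F * composeTensor K Q G := by
  rw [composeTensor, map_mul, PowerSeries.subst_mul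
    (PowerSeries.HasSubst.of_constantCoeff_zero' (constantCoeff_leftSeries hQ))]
  rfl

theorem composeTensor_one {Q : PowerSeries H} (hQ : constantCoeff Q = 0) :
    composeTensor K Q 1 = 1 := by
  rw [composeTensor, map_one, ← PowerSeries.coe_substAlgHom
    (PowerSeries.HasSubst.of_constantCoeff_zero' (constantCoeff_leftSeries hQ)), map_one]

theorem composeTensor_pow {Q : PowerSeries H} (hQ : constantCoeff Q = 0) (F : PowerSeries H)
    (k : ℕ) : composeTensor K Q (F ^ k) = composeTensor K Q F ^ k := by
  rw [composeTensor, map_pow, PowerSeries.subst_pow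
    (PowerSeries.HasSubst.of_constantCoeff_zero' (constantCoeff_leftSeries hQ))]
  rfl

theorem composeTensor_X {Q : PowerSeries H} (hQ : constantCoeff Q = 0) :
    composeTensor K Q PowerSeries.X = leftSeries (K := K) Q := by
  rw [composeTensor, rightSeries, PowerSeries.map_X, PowerSeries.subst_X
    (PowerSeries.HasSubst.of_constantCoeff_zero' (constantCoeff_leftSeries hQ))]

theorem composeTensor_prod {Q : PowerSeries H} (hQ : constantCoeff Q = 0) (F : I → PowerSeries H) :
    composeTensor K Q (∏ i, F i) = ∏ i, composeTensor K Q (F i) :=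
  map_prod (⟨⟨composeTensor K Q, composeTensor_one hQ⟩, composeTensor_mul hQ⟩ :
    PowerSeries H →* PowerSeries (H ⊗[K] H)) F Finset.univ

theorem composeTensor_spow {Q F : PowerSeries H} (hQ : constantCoeff Q = 0)
    (hF : constantCoeff F = 1) (s : K) :
    composeTensor K Q (spow F s) = spow (composeTensor K Q F) s := by
  rw [composeTensor, rightSeries, map_spow, subst_spow (constantCoeff_leftSeries hQ)]
  · rfl
  · rw [← PowerSeries.coeff_zero_eq_constantCoeff_apply, PowerSeries.coeff_map,
      PowerSeries.coeff_zero_eq_constantCoeff_apply, hF, map_one]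

theorem constantCoeff_composeTensor {Q F : PowerSeries H} (hQ : constantCoeff Q = 0)
    (hF : constantCoeff F = 1) : constantCoeff (composeTensor K Q F) = 1 := by
  rw [← PowerSeries.coeff_zero_eq_constantCoeff_apply, coeff_composeTensor hQ]
  simp [hF, Algebra.TensorProduct.one_def]

/-- `H`-linearity of `id ⊗ B` in the left factor. -/
theorem lTensor_coeff_mul_composeTensor (B : H →ₗ[K] H) {Q : PowerSeries H}
    (hQ : constantCoeff Q = 0) (P F : PowerSeries H) (n : ℕ) :
    LinearMap.lTensor H B (coeff n (leftSeries (K := K) P * composeTensor K Q F)) =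
      coeff n (leftSeries (K := K) P *
        composeTensor K Q (PowerSeries.mk fun k => B (coeff k F))) := by
  simp [coeff_leftSeries_mul_composeTensor hQ]

variable [CharZero K] {s : I → K} {B : I → ℕ → H →ₗ[K] H} {T : I → PowerSeries H}

/-- By `mul_spow` the left side splits into x ∏ (T_j ⊗ 1)^{s_j}, which is Q ⊗ 1, times the powers of
the composed T_j. On the right, substitution turns the factor x of Q into Q ⊗ 1, leaving the same
product. -/
theorem invariantCharge_mul_composeTensor (hT : ∀ i, constantCoeff (T i) = 1) :
    invariantCharge s (fun i => leftSeries (K := K) (T i) *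
        composeTensor K (invariantCharge s T) (T i)) =
      composeTensor K (invariantCharge s T) (invariantCharge s T) := by
  have hQ := constantCoeff_invariantCharge s T
  have hl : ∀ i, constantCoeff (leftSeries (K := K) (T i)) = 1 := fun i => by
    rw [← PowerSeries.coeff_zero_eq_constantCoeff_apply, coeff_leftSeries,
      PowerSeries.coeff_zero_eq_constantCoeff_apply, hT, Algebra.TensorProduct.one_def]
  have hr : composeTensor K (invariantCharge s T) (invariantCharge s T) =
      leftSeries (K := K) (invariantCharge s T) *
        ∏ j, spow (composeTensor K (invariantCharge s T) (T j)) (s j) := by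
    conv_lhs => enter [3]; rw [invariantCharge]
    rw [composeTensor_mul hQ, composeTensor_X hQ, composeTensor_prod hQ]
    simp only [composeTensor_spow hQ (hT _)]
  rw [hr, leftSeries, map_invariantCharge, ← leftSeries]
  generalize invariantCharge s T = Q at hQ
  simp only [invariantCharge, mul_spow (hl _) (constantCoeff_composeTensor hQ (hT _)),
    Finset.prod_mul_distrib, mul_assoc]

/-- If the operators `B_{i,m}` are 1-cocycles for the multiplicative coproduct `Δ`, the solution of
the system satisfies `Δ T_i = ∑_j T_i Q^j ⊗ [x^j] T_i`. -/
theorem map_comul_solution (Δ : H →ₐ[K] H ⊗[K] H)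
    (hΔ : ∀ i m h, Δ (B i m h) = B i m h ⊗ₜ[K] 1 + LinearMap.lTensor H (B i m) (Δ h))
    (hT : IsSystemSolution s B (fun _ => 1) T) (i : I) :
    PowerSeries.map (Δ : H →+* H ⊗[K] H) (T i) =
      leftSeries (K := K) (T i) * composeTensor K (invariantCharge s T) (T i) := by
  have hc : ∀ i, constantCoeff (T i) = 1 := fun i => by simpa using hT.constantCoeff i
  have hQ := constantCoeff_invariantCharge s T
  -- In the cocycle identity the terms B(…) ⊗ 1, together with Δ1 = 1 ⊗ 1, add up to T_i ⊗ 1 by the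
  -- original equation; this is the new inhomogeneity.
  have h₁ : IsSystemSolution s (fun i m => LinearMap.lTensor H (B i m))
      (fun i => leftSeries (K := K) (T i))
      (fun i => PowerSeries.map (Δ : H →+* H ⊗[K] H) (T i)) := by
    intro i n
    simp only [← map_invariantCharge, ← map_pow, ← map_mul, PowerSeries.coeff_map, coeff_leftSeries]
    conv_lhs => rw [hT i n]
    conv_rhs => enter [1]; rw [hT i n]
    simp only [RingHom.coe_coe, map_add, map_sum, hΔ, Finset.sum_add_distrib,
      TensorProduct.add_tmul, TensorProduct.sum_tmul, add_assoc]
    congr 1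
    rw [PowerSeries.coeff_one]
    split_ifs <;> simp [Algebra.TensorProduct.one_def]
  -- The products collapse to (T_i ⊗ 1) times the composition of T_i Q^{m+1}, and id ⊗ B passes
  -- through to the right factor, where the original equation applies.
  have h₂ : IsSystemSolution s (fun i m => LinearMap.lTensor H (B i m))
      (fun i => leftSeries (K := K) (T i))
      (fun i => leftSeries (K := K) (T i) * composeTensor K (invariantCharge s T) (T i)) := by
    intro i n
    simp only [invariantCharge_mul_composeTensor hc, mul_assoc, ← composeTensor_pow hQ,
      ← composeTensor_mul hQ, lTensor_coeff_mul_composeTensor _ hQ]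
    simp only [coeff_leftSeries_mul_composeTensor hQ, PowerSeries.coeff_mk]
    rw [Finset.sum_comm]
    simp only [← TensorProduct.tmul_sum]
    -- The equation for T_i in degree d, with the sum extended from d to n terms: the extra ones
    -- vanish because x^{m+1} divides Q^{m+1}.
    have key : ∀ d ∈ Finset.range (n + 1),
        ∑ m ∈ Finset.range n, B i m (coeff d (T i * invariantCharge s T ^ (m + 1))) =
          coeff d (T i) - coeff d (1 : PowerSeries H) := by
      intro d hd
      rw [hT i d, add_sub_cancel_left]
      symm
      refine Finset.sum_subset (by simpa using hd) fun m _ hm => ?_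
      rw [coeff_mul_pow_eq_zero hQ _ (by simp at hm; omega), map_zero]
    have e₁ : ∑ d ∈ Finset.range (n + 1), coeff n (T i * invariantCharge s T ^ d) ⊗ₜ[K]
          ∑ m ∈ Finset.range n, B i m (coeff d (T i * invariantCharge s T ^ (m + 1))) =
        ∑ d ∈ Finset.range (n + 1), coeff n (T i * invariantCharge s T ^ d) ⊗ₜ[K] coeff d (T i) -
        ∑ d ∈ Finset.range (n + 1), coeff n (T i * invariantCharge s T ^ d) ⊗ₜ[K]
          coeff d (1 : PowerSeries H) := by
      rw [← Finset.sum_sub_distrib]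
      exact Finset.sum_congr rfl fun d hd => by rw [key d hd, TensorProduct.tmul_sub]
    have e₂ : ∑ d ∈ Finset.range (n + 1), coeff n (T i * invariantCharge s T ^ d) ⊗ₜ[K]
          coeff d (1 : PowerSeries H) = coeff n (T i) ⊗ₜ[K] 1 := by
      rw [Finset.sum_range_succ']
      simp [PowerSeries.coeff_one]
    rw [e₁, e₂, coeff_leftSeries]
    abel
  exact congrFun ((existsUnique_isSystemSolution s _ _).unique h₁ h₂) i

theorem map_comul_invariantCharge (Δ : H →ₐ[K] H ⊗[K] H)
    (hΔ : ∀ i m h, Δ (B i m h) = B i m h ⊗ₜ[K] 1 + LinearMap.lTensor H (B i m) (Δ h))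
    (hT : IsSystemSolution s B (fun _ => 1) T) :
    PowerSeries.map (Δ : H →+* H ⊗[K] H) (invariantCharge s T) =
      composeTensor K (invariantCharge s T) (invariantCharge s T) := by
  rw [map_invariantCharge, ← invariantCharge_mul_composeTensor fun i => by
    simpa using hT.constantCoeff i]
  simp only [map_comul_solution Δ hΔ hT]

theorem map_counit_solution (ε : H →ₐ[K] K) (hε : ∀ i m h, ε (B i m h) = 0)
    (hT : IsSystemSolution s B (fun _ => 1) T) (i : I) :
    PowerSeries.map (ε : H →+* K) (T i) = 1 := by
  ext n
  rw [PowerSeries.coeff_map, hT i n]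
  simp [hε, PowerSeries.coeff_one, apply_ite]

theorem map_counit_invariantCharge (ε : H →ₐ[K] K) (hε : ∀ i m h, ε (B i m h) = 0)
    (hT : IsSystemSolution s B (fun _ => 1) T) :
    PowerSeries.map (ε : H →+* K) (invariantCharge s T) = PowerSeries.X := by
  rw [map_invariantCharge]
  simp only [map_counit_solution ε hε hT, invariantCharge, one_spow, Finset.prod_const_one, mul_one]

end Cocycle

/-! ### Downsets of disjoint unions and of grafted forests -/

section LowerSets

variable {α β : Type*} [Preorder α] [Preorder β]

/-- A downset of a disjoint union is a pair of downsets. -/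
def lowerSetSumEquiv : LowerSet (α ⊕ β) ≃ LowerSet α × LowerSet β where
  toFun s := (⟨{a | Sum.inl a ∈ s}, fun _ _ h ha => s.lower (Sum.inl_le_inl_iff.2 h) ha⟩,
    ⟨{b | Sum.inr b ∈ s}, fun _ _ h ha => s.lower (Sum.inr_le_inr_iff.2 h) ha⟩)
  invFun p := ⟨{x | Sum.elim (· ∈ p.1) (· ∈ p.2) x}, by
    rintro (a | a) (b | b) h ha
    · exact p.1.lower (Sum.inl_le_inl_iff.1 h) ha
    · exact absurd h Sum.not_inr_le_inl
    · exact absurd h Sum.not_inl_le_inr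
    · exact p.2.lower (Sum.inr_le_inr_iff.1 h) ha⟩
  left_inv s := by
    ext (a | a) <;> rfl
  right_inv p := rfl

/-- A downset of `WithTop α` is everything or a downset of `α`. -/
def lowerSetWithTop : Option (LowerSet α) → LowerSet (WithTop α)
  | none => ⊤
  | some s => ⟨{x | ∃ a ∈ s, (a : WithTop α) = x}, by
      rintro _ b h ⟨a, ha, rfl⟩
      induction b using WithTop.recTopCoe with
      | top => exact absurd h (WithTop.not_top_le_coe a)
      | coe b => exact ⟨b, s.lower (WithTop.coe_le_coe.1 h) ha, rfl⟩⟩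

theorem coe_mem_lowerSetWithTop {s : LowerSet α} {a : α} :
    (a : WithTop α) ∈ lowerSetWithTop (some s) ↔ a ∈ s :=
  ⟨fun ⟨_, hb, h⟩ => WithTop.coe_injective h ▸ hb, fun h => ⟨a, h, rfl⟩⟩

theorem top_notMem_lowerSetWithTop {s : LowerSet α} : ⊤ ∉ lowerSetWithTop (some s) :=
  fun ⟨_, _, h⟩ => WithTop.coe_ne_top h

theorem lowerSetWithTop_bijective : Function.Bijective (lowerSetWithTop (α := α)) := by
  constructor
  · rintro (_ | s) (_ | t) h
    · rfl
    · exact absurd (h ▸ LowerSet.mem_top) (top_notMem_lowerSetWithTop (s := t))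
    · exact absurd (h ▸ LowerSet.mem_top) (top_notMem_lowerSetWithTop (s := s))
    · refine congrArg some (SetLike.ext fun a => ?_)
      exact coe_mem_lowerSetWithTop.symm.trans ((SetLike.ext_iff.1 h (a : WithTop α)).trans
        coe_mem_lowerSetWithTop)
  · intro t
    by_cases ht : ⊤ ∈ t
    · refine ⟨none, ?_⟩
      ext x
      exact ⟨fun _ => t.lower le_top ht, fun _ => LowerSet.mem_top⟩
    · refine ⟨some ⟨(↑) ⁻¹' (t : Set (WithTop α)), fun _ _ h ha =>
        t.lower (WithTop.coe_le_coe.2 h) ha⟩, ?_⟩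
      ext x
      induction x using WithTop.recTopCoe with
      | top => exact ⟨fun h => absurd h top_notMem_lowerSetWithTop, fun h => absurd h ht⟩
      | coe a => exact coe_mem_lowerSetWithTop

end LowerSets

namespace Forest

variable {D : Type*}

theorem iso_of_bijective {F G : Forest D} (f : F.carrier → G.carrier) (hf : Function.Bijective f)
    (hle : ∀ a b, f a ≤ f b ↔ a ≤ b) (hd : ∀ v, G.dec (f v) = F.dec v) : Iso F G :=
  ⟨{ toEquiv := Equiv.ofBijective f hf, map_rel_iff' := fun {a b} => hle a b }, hd⟩

/-- The subsets are arbitrary convex ones, so that the lemma serves both for downsets and for their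
complements. -/
theorem restrict_union (F G : Forest D) (s : Set (F.union G).carrier) (hs : s.OrdConnected)
    (t : Set F.carrier) (ht : t.OrdConnected) (u : Set G.carrier) (hu : u.OrdConnected)
    (h₁ : ∀ a, a ∈ t ↔ Sum.inl a ∈ s) (h₂ : ∀ a, a ∈ u ↔ Sum.inr a ∈ s) :
    Iso ((F.restrict t ht).union (G.restrict u hu)) ((F.union G).restrict s hs) := by
  refine iso_of_bijective (Sum.elim (fun a => ⟨Sum.inl a.1, (h₁ _).1 a.2⟩)
    (fun a => ⟨Sum.inr a.1, (h₂ _).1 a.2⟩)) ⟨?_, ?_⟩ ?_ ?_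
  · rintro (⟨a, ha⟩ | ⟨a, ha⟩) (⟨b, hb⟩ | ⟨b, hb⟩) h
    · cases Sum.inl_injective (congrArg Subtype.val h); rfl
    · cases congrArg Subtype.val h
    · cases congrArg Subtype.val h
    · cases Sum.inr_injective (congrArg Subtype.val h); rfl
  · rintro ⟨(a | a), ha⟩
    · exact ⟨Sum.inl ⟨a, (h₁ a).2 ha⟩, rfl⟩
    · exact ⟨Sum.inr ⟨a, (h₂ a).2 ha⟩, rfl⟩
  · rintro (a | a) (b | b)
    · exact (Sum.inl_le_inl_iff (α := F.carrier) (β := G.carrier)).trans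
        (Sum.inl_le_inl_iff (α := t) (β := u)).symm
    · exact iff_of_false Sum.not_inl_le_inr Sum.not_inl_le_inr
    · exact iff_of_false Sum.not_inr_le_inl Sum.not_inr_le_inl
    · exact (Sum.inr_le_inr_iff (α := F.carrier) (β := G.carrier)).trans
        (Sum.inr_le_inr_iff (α := t) (β := u)).symm
  · rintro (a | a) <;> rfl

theorem iso_restrict_univ (F : Forest D) (s : Set F.carrier) (hs : s.OrdConnected)
    (h : ∀ a, a ∈ s) : Iso (F.restrict s hs) F :=
  iso_of_bijective (fun a : s => a.1) ⟨Subtype.val_injective, fun a => ⟨⟨a, h a⟩, rfl⟩⟩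
    (fun _ _ => Iff.rfl) fun _ => rfl

theorem iso_empty_iff (F : Forest D) : Iso F (empty D) ↔ IsEmpty F.carrier :=
  ⟨fun ⟨e, _⟩ => e.toEquiv.isEmpty_congr.2 inferInstanceAs (IsEmpty Empty), fun h =>
    iso_of_bijective (fun a => h.elim a) ⟨fun a => h.elim a, fun a => a.elim⟩
      (fun a => h.elim a) fun a => h.elim a⟩

theorem restrict_graft_coe (d : D) (F : Forest D) (s : Set (F.graft d).carrier)
    (hs : s.OrdConnected) (t : Set F.carrier) (ht : t.OrdConnected)
    (h : ∀ a : F.carrier, a ∈ t ↔ (a : WithTop F.carrier) ∈ s) (htop : (⊤ : WithTop F.carrier) ∉ s) :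
    Iso (F.restrict t ht) ((F.graft d).restrict s hs) := by
  refine iso_of_bijective (fun a => ⟨(a.1 : WithTop F.carrier), (h _).1 a.2⟩) ⟨?_, ?_⟩ ?_ ?_
  · exact fun a b hab => Subtype.ext (WithTop.coe_injective (congrArg Subtype.val hab))
  · rintro ⟨a, ha⟩
    change WithTop F.carrier at a
    induction a using WithTop.recTopCoe with
    | top => exact absurd ha htop
    | coe a => exact ⟨⟨a, (h a).2 ha⟩, rfl⟩
  · exact fun a b => WithTop.coe_le_coe
  · exact fun _ => rfl

theorem graft_restrict (d : D) (F : Forest D) (s : Set (F.graft d).carrier)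
    (hs : s.OrdConnected) (t : Set F.carrier) (ht : t.OrdConnected)
    (h : ∀ a : F.carrier, a ∈ t ↔ (a : WithTop F.carrier) ∈ s) (htop : (⊤ : WithTop F.carrier) ∈ s) :
    Iso ((F.restrict t ht).graft d) ((F.graft d).restrict s hs) := by
  refine iso_of_bijective (fun x : WithTop t => x.recTopCoe ⟨(⊤ : WithTop F.carrier), htop⟩
    (fun a => ⟨(a.1 : WithTop F.carrier), (h _).1 a.2⟩)) ⟨?_, ?_⟩ ?_ ?_
  · intro a b hab
    change WithTop t at a b
    induction a using WithTop.recTopCoe with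
    | top =>
      induction b using WithTop.recTopCoe with
      | top => rfl
      | coe b => exact absurd (congrArg Subtype.val hab).symm WithTop.coe_ne_top
    | coe a =>
      induction b using WithTop.recTopCoe with
      | top => exact absurd (congrArg Subtype.val hab) WithTop.coe_ne_top
      | coe b =>
        exact congrArg _ (Subtype.ext (WithTop.coe_injective (congrArg Subtype.val hab)))
  · rintro ⟨a, ha⟩
    change WithTop F.carrier at a
    induction a using WithTop.recTopCoe with
    | top => exact ⟨(⊤ : WithTop t), rfl⟩
    | coe a => exact ⟨((⟨a, (h a).2 ha⟩ : t) : WithTop t), rfl⟩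
  · intro a b
    change WithTop t at a b
    induction b using WithTop.recTopCoe with
    | top => exact iff_of_true (le_top (α := WithTop F.carrier)) (le_top (α := WithTop t))
    | coe b =>
      induction a using WithTop.recTopCoe with
      | top =>
        exact iff_of_false (fun h => WithTop.coe_ne_top (top_le_iff (α := WithTop F.carrier).1 h))
          (fun h => WithTop.coe_ne_top (top_le_iff (α := WithTop t).1 h))
      | coe a =>
        exact (WithTop.coe_le_coe (α := F.carrier)).trans (WithTop.coe_le_coe (α := t)).symm
  · intro a
    change WithTop t at a
    induction a using WithTop.recTopCoe <;> rfl

end Forest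

namespace ForestClass

variable {D : Type*}

theorem mk_eq_one_iff (F : Forest D) : mk F = 1 ↔ IsEmpty F.carrier :=
  Quotient.eq.trans F.iso_empty_iff

/-- This is what makes the counit multiplicative. -/
theorem mul_eq_one_iff (F G : ForestClass D) : F * G = 1 ↔ F = 1 ∧ G = 1 := by
  induction F using Quotient.inductionOn with | _ F
  induction G using Quotient.inductionOn with | _ G
  exact (mk_eq_one_iff (F.union G)).trans
    (isEmpty_sum.trans (and_congr (mk_eq_one_iff F).symm (mk_eq_one_iff G).symm))

theorem graft_ne_one (d : D) (F : ForestClass D) : F.graft d ≠ 1 := by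
  induction F using Quotient.inductionOn with | _ F
  exact fun h => ((mk_eq_one_iff (F.graft d)).1 h).elim (⊤ : WithTop F.carrier)

end ForestClass

/-! ### The bialgebra structure of the Connes--Kreimer algebra -/

namespace CK

variable (K : Type*) [Field K] {D : Type*}

theorem of_one : of K (1 : ForestClass D) = 1 := rfl

theorem of_mul (F G : ForestClass D) : of K (F * G) = of K F * of K G :=
  (MonoidAlgebra.single_mul_single (R := K) F G 1 1).trans (by rw [mul_one]; rfl) |>.symm

theorem comul_of (F : ForestClass D) :
    CoalgebraStruct.comul (R := K) (of K F) = comulClass K F :=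
  (basis K).constr_basis K _ F

theorem counit_of [DecidableEq (ForestClass D)] (F : ForestClass D) :
    CoalgebraStruct.counit (R := K) (of K F) = if F = 1 then 1 else 0 := by
  change (basis K).coord 1 (basis K F) = _
  rw [Module.Basis.coord_apply, Module.Basis.repr_self, Finsupp.single_apply]

theorem bPlus_of (d : D) (F : ForestClass D) : bPlus K d (of K F) = of K (F.graft d) :=
  (basis K).constr_basis K _ F

theorem linearMap_ext {M : Type*} [AddCommGroup M] [Module K M] {f g : CK K D →ₗ[K] M}
    (h : ∀ F : Forest D, f (of K (.mk F)) = g (of K (.mk F))) : f = g :=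
  (basis K).ext fun F => Quotient.inductionOn F h

instance (F : Forest D) : Finite (LowerSet F.carrier) :=
  Finite.of_injective (fun s => (s : Set F.carrier)) SetLike.coe_injective

theorem comulForest_empty : comulForest K (Forest.empty D) = 1 := by
  have : Unique (LowerSet (Forest.empty D).carrier) :=
    ⟨⟨⊤⟩, fun s => SetLike.ext fun a => Empty.elim a⟩
  rw [comulForest, finsum_unique, Algebra.TensorProduct.one_def]
  have h : ∀ s (hs : s.OrdConnected),
      ForestClass.mk ((Forest.empty D).restrict s hs) = 1 := fun s hs =>
    (ForestClass.mk_eq_one_iff _).2 ⟨fun a => Empty.elim a.1⟩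
  rw [Forest.down, Forest.up, h, h, of_one]

theorem comulForest_union (F G : Forest D) :
    comulForest K (F.union G) = comulForest K F * comulForest K G := by
  have := Fintype.ofFinite (LowerSet F.carrier)
  have := Fintype.ofFinite (LowerSet G.carrier)
  refine (finsum_eq_of_bijective (g := fun p : LowerSet F.carrier × LowerSet G.carrier =>
    (of K (.mk (F.down p.1)) ⊗ₜ[K] of K (.mk (F.up p.1))) *
      (of K (.mk (G.down p.2)) ⊗ₜ[K] of K (.mk (G.up p.2))))
    lowerSetSumEquiv lowerSetSumEquiv.bijective fun s => ?_).trans ?_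
  swap
  · simp only [comulForest, finsum_eq_sum_of_fintype]
    rw [Fintype.sum_mul_sum, ← Fintype.sum_prod_type']
  rw [Algebra.TensorProduct.tmul_mul_tmul, ← of_mul, ← of_mul]
  congr 2
  · exact Quotient.sound (Forest.restrict_union F G _ _ _ _ _ _ (fun _ => Iff.rfl)
      fun _ => Iff.rfl).symm
  · exact Quotient.sound (Forest.restrict_union F G _ _ _ _ _ _ (fun _ => Iff.rfl)
      fun _ => Iff.rfl).symm

/-- A downset containing the new root is everything and gives the term (tree) ⊗ 1. Any other is a
downset of `F`, whose complement keeps the root; these give (id ⊗ B₊)Δ. -/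
theorem comulForest_graft (d : D) (F : Forest D) :
    comulForest K (F.graft d) = of K (.mk (F.graft d)) ⊗ₜ[K] 1 +
      LinearMap.lTensor (CK K D) (bPlus K d) (comulForest K F) := by
  have := Fintype.ofFinite (LowerSet F.carrier)
  refine (finsum_eq_of_bijective (lowerSetWithTop (α := F.carrier)) lowerSetWithTop_bijective
    fun _ => rfl).symm.trans ?_
  simp only [comulForest, finsum_eq_sum_of_fintype, map_sum, LinearMap.lTensor_tmul, bPlus_of,
    Fintype.sum_option]
  congr 1
  · have h₁ : ForestClass.mk ((F.graft d).down (lowerSetWithTop none)) = .mk (F.graft d) :=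
      Quotient.sound (Forest.iso_restrict_univ _ _ _ fun _ => trivial)
    have h₂ : ForestClass.mk ((F.graft d).up (lowerSetWithTop none)) = 1 :=
      (ForestClass.mk_eq_one_iff _).2 ⟨fun a => a.2 trivial⟩
    rw [h₁, h₂, of_one]
  · refine Finset.sum_congr rfl fun s _ => ?_
    congr 2
    · exact Quotient.sound (Forest.restrict_graft_coe d F _ _ _ _
        (fun _ => coe_mem_lowerSetWithTop.symm) top_notMem_lowerSetWithTop).symm
    · exact Quotient.sound (Forest.graft_restrict d F _ _ _ _
        (fun _ => (not_congr coe_mem_lowerSetWithTop).symm) top_notMem_lowerSetWithTop).symm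

/-- The coproduct as an algebra morphism. -/
def comulAlgHom (D : Type*) : CK K D →ₐ[K] CK K D ⊗[K] CK K D :=
  AlgHom.ofLinearMap CoalgebraStruct.comul
    ((comul_of K 1).trans (comulForest_empty K)) fun x y => by
      refine LinearMap.congr_fun₂ (f := (LinearMap.mul K (CK K D)).compr₂ CoalgebraStruct.comul)
        (g := (LinearMap.mul K (CK K D ⊗[K] CK K D)).compl₁₂ CoalgebraStruct.comul
          CoalgebraStruct.comul) ?_ x y
      refine linearMap_ext K fun F => linearMap_ext K fun G => ?_
      simp only [LinearMap.compr₂_apply, LinearMap.compl₁₂_apply, LinearMap.mul_apply', ← of_mul,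
        comul_of]
      exact comulForest_union K F G

/-- The counit as an algebra morphism. -/
def counitAlgHom (D : Type*) : CK K D →ₐ[K] K :=
  AlgHom.ofLinearMap CoalgebraStruct.counit
    (by classical exact (counit_of K 1).trans (if_pos rfl)) fun x y => by
      classical
      refine LinearMap.congr_fun₂ (f := (LinearMap.mul K (CK K D)).compr₂ CoalgebraStruct.counit)
        (g := (LinearMap.mul K K).compl₁₂ CoalgebraStruct.counit
          CoalgebraStruct.counit) ?_ x y
      refine linearMap_ext K fun F => linearMap_ext K fun G => ?_
      simp only [LinearMap.compr₂_apply, LinearMap.compl₁₂_apply, LinearMap.mul_apply', ← of_mul,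
        counit_of, ForestClass.mul_eq_one_iff]
      split_ifs <;> simp_all

theorem isOneCocycle_bPlus (d : D) : IsOneCocycle (bPlus K d) := by
  intro h
  refine LinearMap.congr_fun (f := CoalgebraStruct.comul ∘ₗ bPlus K d)
    (g := (TensorProduct.mk K (CK K D) (CK K D)).flip 1 ∘ₗ bPlus K d +
      LinearMap.lTensor (CK K D) (bPlus K d) ∘ₗ CoalgebraStruct.comul)
    (linearMap_ext K fun F => ?_) h
  simp only [LinearMap.comp_apply, LinearMap.add_apply, LinearMap.flip_apply,
    TensorProduct.mk_apply, bPlus_of, comul_of]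
  exact comulForest_graft K d F

theorem counit_bPlus (d : D) (h : CK K D) :
    CoalgebraStruct.counit (R := K) (bPlus K d h) = 0 := by
  classical
  refine LinearMap.congr_fun (f := CoalgebraStruct.counit ∘ₗ bPlus K d) (g := 0)
    (linearMap_ext K fun F => ?_) h
  rw [LinearMap.comp_apply, bPlus_of, counit_of, if_neg (ForestClass.graft_ne_one d _)]
  rfl

end CK

/-! ### Bialgebra morphisms from the Riordan Hopf algebra -/

namespace Rio

variable {K H : Type*} [Field K] [CommRing H] [Algebra K H]

/-- The algebra morphism with `Y(x) ↦ T(x)` and `Π(x) ↦ Q(x)`. -/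
def lift (T Q : PowerSeries H) : Rio K →ₐ[K] H :=
  MvPolynomial.aeval fun g => match g with
    | RioGen.pi n => coeff (n + 2) Q
    | RioGen.y n => coeff (n + 1) T

variable {T Q : PowerSeries H}

theorem lift_yGen (hT : constantCoeff T = 1) (n : ℕ) :
    lift (K := K) T Q (yGen K n) = coeff n T := by
  cases n with
  | zero => simp [yGen, hT]
  | succ n => simp [yGen, lift]

theorem lift_piGen (hQ : coeff 1 Q = 1) (n : ℕ) :
    lift (K := K) T Q (piGen K n) = coeff (n + 1) Q := by
  cases n with
  | zero => simp [piGen, hQ]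
  | succ n => simp [piGen, lift]

theorem map_lift_ySeries (hT : constantCoeff T = 1) :
    PowerSeries.map (lift (K := K) T Q : Rio K →+* H) (ySeries K) = T := by
  ext n
  simp [ySeries, lift_yGen hT]

theorem map_lift_piSeries (hQ₀ : constantCoeff Q = 0) (hQ₁ : coeff 1 Q = 1) :
    PowerSeries.map (lift (K := K) T Q : Rio K →+* H) (piSeries K) = Q := by
  ext (_ | n)
  · simp [piSeries, hQ₀]
  · simp [piSeries, PowerSeries.coeff_succ_X_mul, lift_piGen hQ₁]

/-- The coproduct as an algebra morphism. -/
def comulAlgHom (K : Type*) [Field K] : Rio K →ₐ[K] Rio K ⊗[K] Rio K :=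
  MvPolynomial.aeval fun g => match g with
    | RioGen.pi n => comulPi K (n + 1)
    | RioGen.y n => comulY K (n + 1)

theorem map_lift_comul {Δ : H →ₐ[K] H ⊗[K] H} (hT : constantCoeff T = 1)
    (hQ₀ : constantCoeff Q = 0) (hQ₁ : coeff 1 Q = 1)
    (hΔT : PowerSeries.map (Δ : H →+* H ⊗[K] H) T = leftSeries (K := K) T * composeTensor K Q T)
    (hΔQ : PowerSeries.map (Δ : H →+* H ⊗[K] H) Q = composeTensor K Q Q) :
    (Algebra.TensorProduct.map (lift T Q) (lift T Q)).comp (comulAlgHom K) =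
      Δ.comp (lift T Q) := by
  have hY := map_lift_ySeries (K := K) (Q := Q) hT
  have hP := map_lift_piSeries (K := K) (T := T) hQ₀ hQ₁
  have hcoeff : ∀ n (F : PowerSeries (Rio K)), lift T Q (coeff n F) =
      coeff n (PowerSeries.map (lift (K := K) T Q : Rio K →+* H) F) := fun n F => by simp
  refine MvPolynomial.algHom_ext fun g => ?_
  rw [AlgHom.comp_apply, AlgHom.comp_apply, comulAlgHom, lift, MvPolynomial.aeval_X,
    MvPolynomial.aeval_X, ← lift]
  rcases g with n | n
  · have h := congrArg (coeff (n + 2)) hΔQ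
    -- `comulPi` starts at Π^1 ⊗ π_0, so the power-zero term is split off; it vanishes as Q has no
    -- constant term.
    rw [PowerSeries.coeff_map, coeff_composeTensor hQ₀, Finset.sum_range_succ'] at h
    simp only [comulPi, map_sum, Algebra.TensorProduct.map_tmul, lift_piGen hQ₁, hcoeff, map_pow,
      hP]
    simpa [hQ₀] using h.symm
  · have h := congrArg (coeff (n + 1)) hΔT
    rw [PowerSeries.coeff_map, coeff_leftSeries_mul_composeTensor hQ₀] at h
    simp only [comulY, map_sum, Algebra.TensorProduct.map_tmul, lift_yGen hT, hcoeff, map_mul,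
      map_pow, hP, hY]
    exact h.symm

theorem comp_lift_counit {ε : H →ₐ[K] K} (hT : PowerSeries.map (ε : H →+* K) T = 1)
    (hQ : PowerSeries.map (ε : H →+* K) Q = PowerSeries.X) :
    ε.comp (lift T Q) = MvPolynomial.aeval fun _ => 0 := by
  refine MvPolynomial.algHom_ext fun g => ?_
  rw [AlgHom.comp_apply, lift, MvPolynomial.aeval_X, MvPolynomial.aeval_X]
  rcases g with n | n
  · simpa [PowerSeries.coeff_X] using congrArg (coeff (n + 2)) hQ
  · simpa [PowerSeries.coeff_one] using congrArg (coeff (n + 1)) hT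

theorem existsUnique_bialgHom [CoalgebraStruct K H] {Δ : H →ₐ[K] H ⊗[K] H} {ε : H →ₐ[K] K}
    (hΔ : Δ.toLinearMap = CoalgebraStruct.comul) (hε : ε.toLinearMap = CoalgebraStruct.counit)
    (hT : constantCoeff T = 1) (hQ₀ : constantCoeff Q = 0) (hQ₁ : coeff 1 Q = 1)
    (hΔT : PowerSeries.map (Δ : H →+* H ⊗[K] H) T = leftSeries (K := K) T * composeTensor K Q T)
    (hΔQ : PowerSeries.map (Δ : H →+* H ⊗[K] H) Q = composeTensor K Q Q)
    (hεT : PowerSeries.map (ε : H →+* K) T = 1)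
    (hεQ : PowerSeries.map (ε : H →+* K) Q = PowerSeries.X) :
    ∃! φ : Rio K →ₐc[K] H,
      PowerSeries.map (φ : Rio K →+* H) (ySeries K) = T ∧
      PowerSeries.map (φ : Rio K →+* H) (piSeries K) = Q := by
  refine ⟨{ lift T Q with
      map_smul' := map_smul (lift (K := K) T Q)
      counit_comp := ?_
      map_comp_comul := ?_ }, ⟨map_lift_ySeries hT, map_lift_piSeries hQ₀ hQ₁⟩, ?_⟩
  · rw [← hε]
    exact congrArg AlgHom.toLinearMap (comp_lift_counit hεT hεQ)
  · rw [← hΔ]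
    exact congrArg AlgHom.toLinearMap (map_lift_comul hT hQ₀ hQ₁ hΔT hΔQ)
  · rintro φ ⟨h₁, h₂⟩
    have h : (φ : Rio K →ₐ[K] H) = lift T Q := by
      refine MvPolynomial.algHom_ext fun g => ?_
      rw [lift, MvPolynomial.aeval_X]
      rcases g with n | n
      · have := congrArg (coeff (n + 2)) h₂
        rw [PowerSeries.coeff_map, piSeries, PowerSeries.coeff_succ_X_mul,
          PowerSeries.coeff_mk] at this
        exact this
      · have := congrArg (coeff (n + 1)) h₁
        rw [PowerSeries.coeff_map, ySeries, PowerSeries.coeff_mk] at this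
        exact this
    exact DFunLike.ext _ _ fun x => DFunLike.congr_fun h x

end Rio

/-! ### The renormalization group equation -/

section Polynomial

variable {K : Type*} [Field K]

/-- The coproduct of `K[L]` as an algebra morphism. -/
def polynomialComul (K : Type*) [Field K] :
    Polynomial K →ₐ[K] Polynomial K ⊗[K] Polynomial K :=
  Polynomial.aeval
    ((1 : Polynomial K) ⊗ₜ[K] (Polynomial.X : Polynomial K) + Polynomial.X ⊗ₜ[K] 1)

/-- Applying ε ⊗ id to the cocycle identity gives Λp = ε(Λp) + Λp. -/
theorem counit_oneCocycle {Λ : Polynomial K →ₗ[K] Polynomial K} (hΛ : IsOneCocycle Λ)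
    (p : Polynomial K) : Polynomial.aeval (0 : K) (Λ p) = 0 := by
  let E : Polynomial K ⊗[K] Polynomial K →ₐ[K] Polynomial K :=
    Algebra.TensorProduct.productMap ((Algebra.ofId K _).comp (Polynomial.aeval (0 : K)))
      (AlgHom.id K _)
  have hE : ∀ q, E (polynomialComul K q) = q := DFunLike.congr_fun
    (show E.comp (polynomialComul K) = AlgHom.id K _ from
      Polynomial.algHom_ext (by simp [E, polynomialComul]))
  have hEΛ : ∀ t, E (LinearMap.lTensor _ Λ t) = Λ (E t) := by
    intro t
    induction t using TensorProduct.induction_on with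
    | zero => simp
    | tmul a b =>
      simp only [E, LinearMap.lTensor_tmul, Algebra.TensorProduct.productMap_apply_tmul,
        AlgHom.comp_apply, Algebra.ofId_apply, AlgHom.id_apply, ← Algebra.smul_def, map_smul]
    | add x y hx hy => simp only [map_add, hx, hy]
  have h : polynomialComul K (Λ p) =
      Λ p ⊗ₜ[K] 1 + LinearMap.lTensor _ Λ (polynomialComul K p) := hΛ p
  have h' := congrArg E h
  rw [map_add, hE, hEΛ, hE, right_eq_add] at h'
  simpa [E, Algebra.ofId_apply] using h'

/-- The functional `p ↦ [L] p` applied to the left factor of `Δ p` is the derivative. -/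
theorem sum_coeff_one_smul_eq_derivative {ι : Type*} (t : Finset ι) (a b : ι → Polynomial K)
    (p : Polynomial K) (h : polynomialComul K p = ∑ i ∈ t, a i ⊗ₜ[K] b i) :
    Polynomial.derivative p = ∑ i ∈ t, (a i).coeff 1 • b i := by
  -- Evaluating the left factor at the dual number ε makes [L]a · b the ε-part of a ⊗ b, while Δp
  -- becomes p(L + ε) = p + p'ε.
  let E : Polynomial K ⊗[K] Polynomial K →ₐ[K] DualNumber (Polynomial K) :=
    Algebra.TensorProduct.productMap (Polynomial.aeval DualNumber.eps)
      (TrivSqZeroExt.inlAlgHom K (Polynomial K) (Polynomial K))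
  have hε : (DualNumber.eps : DualNumber (Polynomial K)) ^ 2 = 0 := DualNumber.eps_pow_two
  have hl : ∀ q, E (polynomialComul K q) =
      TrivSqZeroExt.inl q + TrivSqZeroExt.inr (Polynomial.derivative q) := by
    intro q
    have h₁ : E.comp (polynomialComul K) = Polynomial.aeval
        (TrivSqZeroExt.inlAlgHom K (Polynomial K) (Polynomial K) Polynomial.X +
          DualNumber.eps) :=
      Polynomial.algHom_ext (by simp [E, polynomialComul])
    have h₂ : ∀ r : Polynomial K,
        Polynomial.aeval (TrivSqZeroExt.inlAlgHom K (Polynomial K) (Polynomial K) Polynomial.X) r =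
          TrivSqZeroExt.inl r := by
      intro r
      rw [Polynomial.aeval_algHom_apply, Polynomial.aeval_X_left_apply]
      rfl
    rw [← AlgHom.comp_apply, h₁, Polynomial.aeval_add_of_sq_eq_zero _ _ _ hε, h₂, h₂,
      DualNumber.inr_eq_smul_eps, ← TrivSqZeroExt.inl_mul_eq_smul]
  have hr : ∀ q r : Polynomial K, (E (q ⊗ₜ[K] r)).snd = q.coeff 1 • r := by
    intro q r
    have := Polynomial.aeval_add_of_sq_eq_zero q (0 : DualNumber (Polynomial K)) _ hε
    rw [zero_add] at this
    simp only [E, Algebra.TensorProduct.productMap_apply_tmul, this]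
    simp [← Polynomial.coeff_zero_eq_aeval_zero', Polynomial.coeff_derivative,
      TrivSqZeroExt.algebraMap_eq_inl', Polynomial.smul_eq_C_mul]
  have h' := congrArg (fun z => (E z).snd) h
  simp only [hl, map_sum, TrivSqZeroExt.snd_sum, hr] at h'
  simpa using h'

/-! ### Constant and linear terms in L -/

/-- The constant term in `L` of a series in `K[L][[x]]`. -/
def constL : PowerSeries (Polynomial K) →+* PowerSeries K :=
  PowerSeries.map ((Polynomial.aeval (0 : K) : Polynomial K →ₐ[K] K) : Polynomial K →+* K)

theorem linL_mul (F G : PowerSeries (Polynomial K)) :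
    linL (F * G) = constL F * linL G + linL F * constL G := by
  ext n
  simp [linL, constL, PowerSeries.coeff_mul, Polynomial.mul_coeff_one,
    Polynomial.coeff_zero_eq_eval_zero, Finset.sum_add_distrib]

theorem linL_one : linL (1 : PowerSeries (Polynomial K)) = 0 := by
  ext n
  rw [linL, PowerSeries.coeff_mk, PowerSeries.coeff_one]
  split_ifs <;> simp [Polynomial.coeff_one]

theorem linL_X : linL (PowerSeries.X : PowerSeries (Polynomial K)) = 0 := by
  ext n
  rw [linL, PowerSeries.coeff_mk, PowerSeries.coeff_X]
  split_ifs <;> simp [Polynomial.coeff_one]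

theorem linL_pow {F : PowerSeries (Polynomial K)} (n : ℕ) :
    linL (F ^ (n + 1)) = (n + 1 : ℕ) * constL F ^ n * linL F := by
  induction n with
  | zero => simp
  | succ n ih =>
    rw [pow_succ, linL_mul, ih, map_pow]
    push_cast
    ring

theorem linL_prod {I : Type*} (t : Finset I) {F : I → PowerSeries (Polynomial K)}
    (hF : ∀ i ∈ t, constL (F i) = 1) : linL (∏ i ∈ t, F i) = ∑ i ∈ t, linL (F i) := by
  classical
  induction t using Finset.induction_on with
  | empty => exact linL_one
  | insert i t hi ih =>
    have h : ∀ j ∈ t, constL (F j) = 1 := fun j hj => hF j (Finset.mem_insert_of_mem hj)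
    rw [Finset.prod_insert hi, Finset.sum_insert hi, linL_mul, ih h, map_prod,
      Finset.prod_congr rfl h, hF i (Finset.mem_insert_self i t)]
    simp [add_comm]

theorem constL_spow {F : PowerSeries (Polynomial K)} (hF : constL F = 1) (s : K) :
    constL (spow F s) = 1 := by
  rw [constL, map_spow, ← constL, hF, one_spow]

/-- F - 1 vanishes at L = 0, so only the k = 1 term of the binomial series has a linear part. -/
theorem linL_spow {F : PowerSeries (Polynomial K)} (hF : constL F = 1)
    (hF₀ : constantCoeff F = 1) (s : K) : linL (spow F s) = s • linL F := by
  have hsub : linL (F - 1) = linL F := by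
    ext n
    simpa [linL, sub_eq_zero] using congrArg (coeff n) (linL_one (K := K))
  have h₀ : constL (F - 1) = 0 := by rw [map_sub, hF, map_one, sub_self]
  have h : ∀ k n, (coeff n ((F - 1) ^ k)).coeff 1 = if k = 1 then (coeff n F).coeff 1 else 0 := by
    intro k n
    have e : (coeff n ((F - 1) ^ k)).coeff 1 = coeff n (linL ((F - 1) ^ k)) := by simp [linL]
    rw [e]
    rcases k with _ | _ | k
    · simp [linL_one]
    · simp only [zero_add, pow_one, hsub, if_true]
      simp [linL]
    · rw [linL_pow, h₀]
      simp
  ext n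
  -- The bound n + 1 keeps k = 1 in the range even for n = 0.
  simp only [linL, PowerSeries.coeff_mk, coeff_spow hF₀ s (Nat.le_succ n), map_smul,
    Polynomial.finsetSum_coeff, Polynomial.coeff_smul, h]
  simp [fieldChoose]

variable {I : Type*} [Fintype I] {s : I → K} {G : I → PowerSeries (Polynomial K)}

theorem linL_invariantCharge (hG : ∀ i, constL (G i) = 1) (hG₀ : ∀ i, constantCoeff (G i) = 1) :
    linL (invariantCharge s G) = betaFunction s G := by
  rw [invariantCharge, linL_mul, linL_X, zero_mul, add_zero,
    linL_prod _ fun i _ => constL_spow (hG i) _, constL, PowerSeries.map_X, Finset.mul_sum,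
    betaFunction]
  exact Finset.sum_congr rfl fun j _ => by rw [linL_spow (hG j) (hG₀ j), mul_smul_comm]

variable [CharZero K] {Λ : I → ℕ+ → Polynomial K →ₗ[K] Polynomial K}

theorem isDSESolution_iff : IsDSESolution s Λ G ↔
    IsSystemSolution s (fun i m => Λ i m.succPNat) (fun _ => 1) G := by
  -- The exponent law needs constant term 1, which each of the two systems forces through its
  -- degree-zero equation.
  have key : (∀ i, constantCoeff (G i) = 1) → ∀ i n, ∀ m ∈ Finset.range n,
      coeff (n - (m + 1)) (G i * ∏ j, spow (G j) (s j * ((m + 1 : ℕ) : K))) =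
        coeff n (G i * invariantCharge s G ^ (m + 1)) := by
    intro h i n m hm
    have hm : m + 1 ≤ n := Finset.mem_range.1 hm
    rw [invariantCharge, mul_pow, mul_left_comm, PowerSeries.coeff_X_pow_mul', if_pos hm,
      ← Finset.prod_pow]
    simp only [spow_mul_natCast (h _)]
  constructor
  · intro h i n
    rw [h i n]
    refine congrArg _ (Finset.sum_congr rfl fun m hm => ?_)
    rw [key (fun i => by simpa using h i 0) i n m hm]
  · intro h i n
    rw [h i n]
    refine congrArg _ (Finset.sum_congr rfl fun m hm => ?_)
    rw [key (fun i => by simpa using h.constantCoeff i) i n m hm]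

theorem IsDSESolution.satisfiesRGE (hΛ : ∀ i k, IsOneCocycle (Λ i k))
    (h : IsDSESolution s Λ G) (i : I) :
    SatisfiesRGE (betaFunction s G) (linL (G i)) (G i) := by
  have hS := isDSESolution_iff.1 h
  have hc : ∀ i, constantCoeff (G i) = 1 := fun i => by simpa using hS.constantCoeff i
  have hQ := constantCoeff_invariantCharge s G
  have hG : ∀ i, constL (G i) = 1 :=
    map_counit_solution _ (fun i m p => counit_oneCocycle (hΛ i _) p) hS
  have hQX : constL (invariantCharge s G) = PowerSeries.X :=
    map_counit_invariantCharge _ (fun i m p => counit_oneCocycle (hΛ i _) p) hS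
  have hΔ := map_comul_solution (polynomialComul K) (fun i m p => hΛ i m.succPNat p) hS i
  rw [SatisfiesRGE, sub_sub, sub_eq_zero]
  ext1 n
  have hn := congrArg (coeff n) hΔ
  rw [PowerSeries.coeff_map, coeff_leftSeries_mul_composeTensor hQ] at hn
  have hd := sum_coeff_one_smul_eq_derivative _ _ _ _ hn
  rw [derivL, PowerSeries.coeff_mk, hd]
  -- Leibniz rule for the linear term, with G_i = 1 and Q = x at L = 0.
  have e : ∀ d, (coeff n (G i * invariantCharge s G ^ d)).coeff 1 =
      coeff n (linL (invariantCharge s G ^ d)) + coeff n (linL (G i) * PowerSeries.X ^ d) := by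
    intro d
    have : (coeff n (G i * invariantCharge s G ^ d)).coeff 1 =
      coeff n (linL (G i * invariantCharge s G ^ d)) := by simp [linL]
    rw [this, linL_mul, hG, map_pow, hQX, one_mul, map_add]
  simp only [e, add_smul, Finset.sum_add_distrib, map_add]
  congr 1
  -- Here ∑_d d x^{d-1} β [x^d]G_i is matched with β ∂G_i/∂x. The d = 0 term is zero; after shifting
  -- d, the convolution has one more term than the sum, and it vanishes because β has no constant
  -- term.
  · rw [Finset.sum_range_succ']
    simp only [linL_pow, hQX, linL_invariantCharge hG hc, pow_zero, linL_one, map_zero, zero_smul,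
      add_zero]
    rw [mul_comm, PowerSeries.coeff_mul, Finset.Nat.sum_antidiagonal_eq_sum_range_succ_mk,
      Finset.sum_range_succ, Nat.sub_self]
    have h0 : coeff 0 (betaFunction s G) = 0 := by simp [betaFunction]
    rw [PowerSeries.coeff_map, h0, map_zero, mul_zero, add_zero]
    refine Finset.sum_congr rfl fun d hd => ?_
    have hdn : d ≤ n := (Finset.mem_range.1 hd).le
    rw [mul_right_comm, PowerSeries.coeff_mul_X_pow', if_pos hdn, PowerSeries.coeff_map, derivX,
      PowerSeries.coeff_derivative, ← map_natCast (PowerSeries.C (R := K)),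
      PowerSeries.coeff_C_mul, Polynomial.smul_eq_C_mul, map_mul, map_natCast]
    push_cast
    ring
  · rw [mul_comm, PowerSeries.coeff_mul, Finset.Nat.sum_antidiagonal_eq_sum_range_succ_mk]
    refine Finset.sum_congr rfl fun d hd => ?_
    rw [PowerSeries.coeff_mul_X_pow', if_pos (Finset.mem_range_succ_iff.1 hd),
      PowerSeries.coeff_map, Polynomial.smul_eq_C_mul, mul_comm]

end Polynomial

end DysonSchwinger

end

theorem mainTheorem8 {K : Type*} [Field K] [CharZero K] {I : Type*} [Fintype I] (s : I → K) :
    (∃! T : I → PowerSeries (DysonSchwinger.CK K (I × ℕ+)),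
        DysonSchwinger.IsCombSolution s T) ∧
    (∀ T : I → PowerSeries (DysonSchwinger.CK K (I × ℕ+)),
        DysonSchwinger.IsCombSolution s T →
        ∀ i : I, ∃! φ : DysonSchwinger.Rio K →ₐc[K] DysonSchwinger.CK K (I × ℕ+),
          PowerSeries.map (φ : DysonSchwinger.Rio K →+* DysonSchwinger.CK K (I × ℕ+))
              (DysonSchwinger.Rio.ySeries K) = T i ∧
          PowerSeries.map (φ : DysonSchwinger.Rio K →+* DysonSchwinger.CK K (I × ℕ+))
              (DysonSchwinger.Rio.piSeries K) = DysonSchwinger.invariantCharge s T) ∧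
    (∀ Λ : I → ℕ+ → Polynomial K →ₗ[K] Polynomial K,
        (∀ i k, DysonSchwinger.IsOneCocycle (Λ i k)) →
        (∃! G : I → PowerSeries (Polynomial K), DysonSchwinger.IsDSESolution s Λ G) ∧
        ∀ G : I → PowerSeries (Polynomial K), DysonSchwinger.IsDSESolution s Λ G →
          ∀ i : I, DysonSchwinger.SatisfiesRGE (DysonSchwinger.betaFunction s G)
            (DysonSchwinger.linL (G i)) (G i)) := by
  open DysonSchwinger in
  refine ⟨existsUnique_isSystemSolution s (fun i m => CK.bPlus K (i, m.succPNat)) fun _ => 1,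
    fun T hT i => ?_, fun Λ hΛ => ⟨?_, fun G hG => hG.satisfiesRGE hΛ⟩⟩
  · have hS : IsSystemSolution s (fun i m => CK.bPlus K (i, m.succPNat)) (fun _ => 1) T := hT
    have hΔ : ∀ (i : I) (m : ℕ) (h : CK K (I × ℕ+)),
        CK.comulAlgHom K (I × ℕ+) (CK.bPlus K (i, m.succPNat) h) =
          CK.bPlus K (i, m.succPNat) h ⊗ₜ[K] 1 +
            LinearMap.lTensor _ (CK.bPlus K (i, m.succPNat)) (CK.comulAlgHom K (I × ℕ+) h) :=
      fun i m h => CK.isOneCocycle_bPlus K (i, m.succPNat) h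
    have hε : ∀ (i : I) (m : ℕ) (h : CK K (I × ℕ+)),
        CK.counitAlgHom K (I × ℕ+) (CK.bPlus K (i, m.succPNat) h) = 0 :=
      fun i m h => CK.counit_bPlus K (i, m.succPNat) h
    exact Rio.existsUnique_bialgHom (Δ := CK.comulAlgHom K (I × ℕ+))
      (ε := CK.counitAlgHom K (I × ℕ+)) rfl rfl
      (by simpa using hS.constantCoeff i) (constantCoeff_invariantCharge s T)
      (coeff_one_invariantCharge s T) (map_comul_solution _ hΔ hS i)
      (map_comul_invariantCharge _ hΔ hS) (map_counit_solution _ hε hS i)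
      (map_counit_invariantCharge _ hε hS)
  · simpa only [isDSESolution_iff] using existsUnique_isSystemSolution s
      (fun i m => Λ i m.succPNat) fun _ => 1
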